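/- Let $d\ge 1$ be an integer and $\nu\ge 0$ a real number. Let $\mathbb{B}^d$ be the closed Euclidean unit ball of $\mathbb{R}^d$ and let $F_\nu$ be the probability measure on $\mathbb{B}^d$ whose density with respect to Lebesgue measure is proportional to $(1-\|x\|^2)^{\nu-\frac12}$. For an integer $n\ge 1$ let $\mathcal{Y}_n$ be the space of real polynomials in $d$ variables of total degree at most $n$ that are orthogonal in $L^2(\mathbb{B}^d,F_\nu)$ to every polynomial of total degree less than $n$. Then there is a constant $C>0$, depending only on $d$ and $\nu$, such that for every integer $n\ge 1$ and every $L^2(\mathbb{B}^d,F_\nu)$-orthonormal basis $\{p_{k,n}\}_{k=1}^{\dim\mathcal{Y}_n}$ of $\mathcal{Y}_n$, $$\|p_{k,n}\|_\infty\le C\,n^{\nu+\frac{d-1}{2}}\quad\text{for } 1\le k\le\dim\mathcal{Y}_n,\qquad \Big\|\sum_{k=1}^{\dim\mathcal{Y}_n}p_{k,n}^2\Big\|_\infty\le C\,n^{2\nu+d-1},$$ where $\|\cdot\|_\infty$ is the supremum norm on $\mathbb{B}^d$. -/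

import Mathlib

open MeasureTheory

namespace BallPoly

noncomputable section

/-- The closed Euclidean unit ball `𝔹ᵈ` of `ℝᵈ`. -/
abbrev unitBall (d : ℕ) : Set (EuclideanSpace ℝ (Fin d)) :=
  Metric.closedBall 0 1

/-- The measure on `𝔹ᵈ` with the unnormalized density `(1 - ‖x‖²)^(ν - 1/2)`
with respect to Lebesgue measure. -/
def weightMeasure (d : ℕ) (ν : ℝ) : Measure (EuclideanSpace ℝ (Fin d)) :=
  (volume.restrict (unitBall d)).withDensity
    fun x => ENNReal.ofReal ((1 - ‖x‖ ^ 2) ^ (ν - 1 / 2))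

/-- The distribution `F_ν` on `𝔹ᵈ`: the previous measure divided by its total mass (which is
finite and nonzero for `ν > -1/2`). -/
def F (d : ℕ) (ν : ℝ) : Measure (EuclideanSpace ℝ (Fin d)) :=
  (weightMeasure d ν Set.univ)⁻¹ • weightMeasure d ν

/-- The polynomial function on `ℝᵈ` given by a polynomial in `d` variables. -/
def polyFun {d : ℕ} (p : MvPolynomial (Fin d) ℝ) (x : EuclideanSpace ℝ (Fin d)) : ℝ :=
  MvPolynomial.eval (fun i => x i) p

/-- The inner product of `L²(𝔹ᵈ, F_ν)` on polynomials. -/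
def polyInner (d : ℕ) (ν : ℝ) (p q : MvPolynomial (Fin d) ℝ) : ℝ :=
  ∫ x, polyFun p x * polyFun q x ∂(F d ν)

theorem continuous_polyFun {d : ℕ} (p : MvPolynomial (Fin d) ℝ) : Continuous (polyFun p) := by
  unfold polyFun
  exact (MvPolynomial.continuous_eval p).comp (by fun_prop)

instance isFiniteMeasure_F (d : ℕ) (ν : ℝ) : IsFiniteMeasure (F d ν) := by
  refine ⟨?_⟩
  simp only [F, Measure.smul_apply, smul_eq_mul]
  exact lt_of_le_of_lt (ENNReal.inv_mul_le_one _) ENNReal.one_lt_top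

theorem ae_mem_unitBall (d : ℕ) (ν : ℝ) : ∀ᵐ x ∂(F d ν), x ∈ unitBall d := by
  refine Measure.ae_smul_measure ?_ _
  refine (withDensity_absolutelyContinuous _ _).ae_le ?_
  exact ae_restrict_mem Metric.isClosed_closedBall.measurableSet

theorem integrable_of_continuous {d : ℕ} {ν : ℝ} {f : EuclideanSpace ℝ (Fin d) → ℝ}
    (hf : Continuous f) : Integrable f (F d ν) := by
  obtain ⟨M, hM⟩ := (isCompact_closedBall (0 : EuclideanSpace ℝ (Fin d)) 1).exists_bound_of_continuousOn
    hf.continuousOn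
  refine Integrable.of_bound hf.aestronglyMeasurable M ?_
  filter_upwards [ae_mem_unitBall d ν] with x hx using hM x hx

theorem integrable_mul (d : ℕ) (ν : ℝ) (p q : MvPolynomial (Fin d) ℝ) :
    Integrable (fun x => polyFun p x * polyFun q x) (F d ν) :=
  integrable_of_continuous ((continuous_polyFun p).mul (continuous_polyFun q))

/-- The space `𝒴ₙ` of orthogonal polynomials of degree `n` in `d` variables for `F_ν`: the
polynomials of total degree at most `n` that are orthogonal to all polynomials of degree less
than `n`. -/
def Y (d : ℕ) (ν : ℝ) (n : ℕ) : Submodule ℝ (MvPolynomial (Fin d) ℝ) where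
  carrier := {p | p.totalDegree ≤ n ∧
    ∀ q : MvPolynomial (Fin d) ℝ, q.totalDegree < n → polyInner d ν p q = 0}
  zero_mem' := by simp [polyInner, polyFun]
  add_mem' := by
    rintro a b ⟨ha, ha'⟩ ⟨hb, hb'⟩
    refine ⟨(MvPolynomial.totalDegree_add a b).trans (max_le ha hb), fun q hq => ?_⟩
    have h : polyInner d ν (a + b) q = polyInner d ν a q + polyInner d ν b q := by
      unfold polyInner
      rw [← integral_add (integrable_mul d ν a q) (integrable_mul d ν b q)]
      simp [polyFun, add_mul]
    rw [h, ha' q hq, hb' q hq, add_zero]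
  smul_mem' := by
    rintro c a ⟨ha, ha'⟩
    refine ⟨(MvPolynomial.totalDegree_smul_le c a).trans ha, fun q hq => ?_⟩
    have h : polyInner d ν (c • a) q = c * polyInner d ν a q := by
      unfold polyInner
      rw [← integral_const_mul]
      simp [polyFun, mul_assoc]
    rw [h, ha' q hq, mul_zero]

/-- The restriction of a polynomial to `𝔹ᵈ`; its norm in `C(𝔹ᵈ, ℝ)` is the sup norm on `𝔹ᵈ`. -/
def onBall {d : ℕ} (p : MvPolynomial (Fin d) ℝ) : C(unitBall d, ℝ) :=
  ⟨fun x => polyFun p x, (continuous_polyFun p).comp continuous_subtype_val⟩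

/-- A basis of `𝒴ₙ` that is orthonormal in `L²(𝔹ᵈ, F_ν)`. -/
def IsOrthonormalBasis {d : ℕ} {ν : ℝ} {n : ℕ}
    (p : Module.Basis (Fin (Module.finrank ℝ (Y d ν n))) ℝ (Y d ν n)) : Prop :=
  ∀ j k, polyInner d ν (p j) (p k) = if j = k then 1 else 0

end

end BallPoly

/-!
A point `x` of the ball lifts to `X̂ = (x, √(1 - ‖x‖²))` on the unit sphere of `ℝᵈ × ℝ`, and a
random `Y` of law `F_ν` lifts to `Ŷ = (Y, t √(1 - ‖Y‖²))`, where `t` is independent of `Y` and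
follows the Gegenbauer law of index `ν - 1/2` (a random sign when `ν = 0`). The moments of `Ŷ` are
rotation invariant: `𝔼 ⟪v, Ŷ⟫ ^ m` is `‖v‖ ^ m` times the `m`-th moment of the Gegenbauer law of
index `λ = ν + (d - 1) / 2`. By polarization, the joint moments of `⟪v, Ŷ⟫` and `⟪w, Ŷ⟫` depend
only on the Gram matrix of `v` and `w` and on `λ`, so they may be computed for `d = 1`. Hence the
conditional expectation of `q(Y)` given `s = ⟪X̂, Ŷ⟫` is a polynomial `g(s)` with `deg g ≤ deg q`
and `g(1) = q(x)`. For `q ∈ 𝒴ₙ` it is an orthogonal polynomial of degree `n` for the law of `s`,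
which is the Gegenbauer law of index `λ`, and `𝔼 g² ≤ ‖q‖²`. Differentiation maps orthogonal
polynomials of index `λ` to those of index `λ + 1`; iterating it `n` times gives
`g(1)² ≤ C n^(2λ) 𝔼 g²` and therefore `q(x)² ≤ C n^(2λ) ‖q‖²`. Both bounds follow by taking
`q = ∑ₖ pₖ(x) pₖ`.
-/

namespace BallPoly

noncomputable section

local notation "poch(" x ", " n ")" => Polynomial.eval x (ascPochhammer ℝ n)

section Pochhammer

theorem ascPochhammer_succ_eval_left (x : ℝ) (n : ℕ) : poch(x, n + 1) = x * poch(x + 1, n) := by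
  simp [ascPochhammer_succ_left]

theorem ascPochhammer_eval_add_one_le {b : ℝ} (hb : 0 ≤ b) (n : ℕ) :
    poch(b + 1, n) ≤ n.factorial * Real.exp (b * harmonic n) := by
  induction n with
  | zero => simp
  | succ n ih =>
    have hfactor : b + 1 + n ≤ (n + 1) * Real.exp (b * (n + 1 : ℝ)⁻¹) := by
      have h := mul_le_mul_of_nonneg_left (Real.add_one_le_exp (b * (n + 1 : ℝ)⁻¹))
        n.cast_add_one_pos.le
      refine le_of_eq_of_le ?_ h
      field_simp
      ring
    calc poch(b + 1, n + 1) = poch(b + 1, n) * (b + 1 + n) := ascPochhammer_succ_eval ..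
      _ ≤ n.factorial * Real.exp (b * harmonic n) * ((n + 1) * Real.exp (b * (n + 1 : ℝ)⁻¹)) := by
        gcongr
      _ = _ := by
        rw [harmonic_succ, Nat.factorial_succ]
        push_cast
        rw [mul_add b, Real.exp_add]
        ring

theorem exp_mul_harmonic_le {b : ℝ} (hb : 0 ≤ b) {n : ℕ} (hn : n ≠ 0) :
    Real.exp (b * harmonic n) ≤ Real.exp b * (n : ℝ) ^ b := by
  rw [Real.rpow_def_of_pos (by positivity), ← Real.exp_add, Real.exp_le_exp]
  calc b * harmonic n ≤ b * (1 + Real.log n) := by gcongr; exact harmonic_le_one_add_log n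
    _ = _ := by ring

theorem ascPochhammer_eval_add_one_two_mul_le {b : ℝ} (hb : 0 ≤ b) {n : ℕ} (hn : 1 ≤ n) :
    poch(b + 1, 2 * n) ≤
      (b + 2) * Real.exp b * (n : ℝ) ^ b * (n.factorial * poch(n + b, n)) := by
  have hnb : 0 < n + b := add_pos_of_pos_of_nonneg (Nat.cast_pos.2 hn) hb
  have hsplit : poch(b + 1, 2 * n) * (n + b) = poch(b + 1, n) * poch(n + b, n) * (2 * n + b) := by
    have hadd := congrArg (Polynomial.eval (b + 1)) (ascPochhammer_mul ℝ n n)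
    have hshift := ascPochhammer_succ_eval_left (n + b) n
    rw [ascPochhammer_succ_eval] at hshift
    simp only [Polynomial.eval_mul, Polynomial.eval_comp, Polynomial.eval_add, Polynomial.eval_X,
      Polynomial.eval_natCast] at hadd
    rw [two_mul, ← hadd, show b + 1 + (n : ℝ) = n + b + 1 by ring]
    linear_combination -poch(b + 1, n) * hshift
  have hp : 0 < poch(n + b, n) := ascPochhammer_pos _ _ hnb
  refine le_of_mul_le_mul_right ?_ hnb
  calc _ = poch(b + 1, n) * poch(n + b, n) * (2 * n + b) := hsplit
    _ ≤ n.factorial * (Real.exp b * (n : ℝ) ^ b) * poch(n + b, n) * ((b + 2) * (n + b)) := by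
      gcongr
      · exact (ascPochhammer_eval_add_one_le hb n).trans
          (by gcongr; exact exp_mul_harmonic_le hb (by omega))
      · nlinarith [mul_nonneg hb n.cast_nonneg]
    _ = _ := by ring

end Pochhammer

section Gegenbauer

open Polynomial

/-- The functional `E` satisfies the Pearson equation of the Gegenbauer weight
`(1 - s²)^(λ - 1/2)`, hence is a multiple of integration against that weight over `[-1, 1]`. -/
def IsGegenbauer (E : ℝ[X] →ₗ[ℝ] ℝ) (lam : ℝ) : Prop :=
  ∀ f, E ((1 - X ^ 2) * derivative f) = (2 * lam + 1) * E (X * f)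

/-- The functional `f ↦ E ((1 - s²) f)`; it turns the Gegenbauer functional of index `λ` into that
of index `λ + 1`. -/
def raiseIndex (E : ℝ[X] →ₗ[ℝ] ℝ) : ℝ[X] →ₗ[ℝ] ℝ :=
  E ∘ₗ LinearMap.mulLeft ℝ (1 - X ^ 2)

/-- The adjoint of the derivative, from the inner product with the Gegenbauer weight of index `λ`
to that of index `λ + 1`. -/
def adjointDerivative (lam : ℝ) (f : ℝ[X]) : ℝ[X] :=
  C (2 * lam + 1) * (X * f) - (1 - X ^ 2) * derivative f

/-- The polynomial `g` is an orthogonal polynomial of degree `n`, possibly zero, for the bilinear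
form `(f, g) ↦ E (f g)`. -/
structure IsOrthogonalPoly (E : ℝ[X] →ₗ[ℝ] ℝ) (n : ℕ) (g : ℝ[X]) : Prop where
  mem_degreeLT : g ∈ degreeLT ℝ (n + 1)
  map_mul_eq_zero : ∀ f ∈ degreeLT ℝ n, E (g * f) = 0

theorem map_C_mul (E : ℝ[X] →ₗ[ℝ] ℝ) (c : ℝ) (f : ℝ[X]) : E (C c * f) = c * E f := by
  rw [← smul_eq_C_mul, map_smul, smul_eq_mul]

theorem mem_degreeLT_iff_coeff {n : ℕ} {f : ℝ[X]} :
    f ∈ degreeLT ℝ n ↔ ∀ k, n ≤ k → f.coeff k = 0 := by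
  rw [mem_degreeLT, degree_lt_iff_coeff_zero]

theorem derivative_mem_degreeLT {n : ℕ} {f : ℝ[X]} (hf : f ∈ degreeLT ℝ (n + 1)) :
    derivative f ∈ degreeLT ℝ n := by
  rw [mem_degreeLT_iff_coeff] at hf ⊢
  intro k hk
  rw [coeff_derivative, hf (k + 1) (by gcongr), zero_mul]

theorem coeff_adjointDerivative_succ (lam : ℝ) (f : ℝ[X]) (k : ℕ) :
    (adjointDerivative lam f).coeff (k + 1) =
      (k + 1 + 2 * lam) * f.coeff k - (k + 2) * f.coeff (k + 2) := by
  have h : (X ^ 2 * derivative f).coeff (k + 1) = k * f.coeff k := by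
    rcases k with _ | k
    · simp [coeff_X_pow_mul']
    · rw [coeff_X_pow_mul, coeff_derivative]
      push_cast
      ring
  rw [adjointDerivative, sub_mul, one_mul, coeff_sub, coeff_sub, coeff_C_mul, coeff_X_mul,
    coeff_derivative, h]
  push_cast
  ring

theorem adjointDerivative_mem_degreeLT (lam : ℝ) {n : ℕ} {f : ℝ[X]} (hf : f ∈ degreeLT ℝ n) :
    adjointDerivative lam f ∈ degreeLT ℝ (n + 1) := by
  rw [mem_degreeLT_iff_coeff] at hf ⊢
  rintro (_ | k) hk
  · omega
  · rw [coeff_adjointDerivative_succ, hf k (by omega), hf (k + 2) (by omega)]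
    ring

theorem eval_one_adjointDerivative (lam : ℝ) (f : ℝ[X]) :
    (adjointDerivative lam f).eval 1 = (2 * lam + 1) * f.eval 1 := by
  simp [adjointDerivative]

theorem raiseIndex_apply (E : ℝ[X] →ₗ[ℝ] ℝ) (f : ℝ[X]) :
    raiseIndex E f = E ((1 - X ^ 2) * f) := rfl

namespace IsGegenbauer

variable {E : ℝ[X] →ₗ[ℝ] ℝ} {lam : ℝ}

theorem raise (hE : IsGegenbauer E lam) : IsGegenbauer (raiseIndex E) (lam + 1) := by
  intro f
  have h := hE ((1 - X ^ 2) * f)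
  rw [derivative_mul, show derivative (1 - X ^ 2 : ℝ[X]) = -(C 2 * X) by
      simp [C_ofNat, one_add_one_eq_two],
    show (1 - X ^ 2) * (-(C 2 * X) * f + (1 - X ^ 2) * derivative f) =
      (1 - X ^ 2) * ((1 - X ^ 2) * derivative f) - C 2 * ((1 - X ^ 2) * (X * f)) by ring,
    map_sub, map_C_mul, mul_left_comm X] at h
  rw [raiseIndex_apply, raiseIndex_apply]
  linear_combination h

theorem raiseIndex_one (hE : IsGegenbauer E lam) :
    (2 * lam + 2) * raiseIndex E 1 = (2 * lam + 1) * E 1 := by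
  have h := hE X
  rw [derivative_X, show X * X = 1 - (1 - X ^ 2) * (1 : ℝ[X]) by ring, map_sub] at h
  rw [raiseIndex_apply]
  linear_combination h

theorem raiseIndex_one_ne_zero (hE : IsGegenbauer E lam) (hlam : -(1 / 2) < lam)
    (hE1 : E 1 ≠ 0) : raiseIndex E 1 ≠ 0 := by
  have h := mul_ne_zero (show 2 * lam + 1 ≠ 0 by linarith) hE1
  rw [← hE.raiseIndex_one] at h
  exact right_ne_zero_of_mul h

theorem raiseIndex_derivative_mul (hE : IsGegenbauer E lam) (r f : ℝ[X]) :
    raiseIndex E (derivative r * f) = E (r * adjointDerivative lam f) := by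
  have h := hE (r * f)
  rw [derivative_mul, mul_add, map_add] at h
  rw [raiseIndex_apply, adjointDerivative,
    show r * (C (2 * lam + 1) * (X * f) - (1 - X ^ 2) * derivative f) =
      C (2 * lam + 1) * (X * (r * f)) - (1 - X ^ 2) * (r * derivative f) by ring,
    map_sub, map_C_mul]
  linear_combination h

theorem isOrthogonalPoly_derivative (hE : IsGegenbauer E lam) {n : ℕ} {g : ℝ[X]}
    (hg : IsOrthogonalPoly E (n + 1) g) : IsOrthogonalPoly (raiseIndex E) n (derivative g) where
  mem_degreeLT := derivative_mem_degreeLT hg.mem_degreeLT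
  map_mul_eq_zero f hf := by
    rw [hE.raiseIndex_derivative_mul]
    exact hg.map_mul_eq_zero _ (adjointDerivative_mem_degreeLT lam hf)

theorem eq_zero_of_forall_map_mul_eq_zero (hE : IsGegenbauer E lam) (hlam : -(1 / 2) < lam)
    (hE1 : E 1 ≠ 0) {n : ℕ} {r : ℝ[X]} (hr : r ∈ degreeLT ℝ n)
    (h : ∀ f ∈ degreeLT ℝ n, E (r * f) = 0) : r = 0 := by
  induction n generalizing E lam r with
  | zero => simpa [mem_degreeLT] using hr
  | succ n ih =>
    have hderiv : derivative r = 0 := by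
      refine ih hE.raise (by linarith) (hE.raiseIndex_one_ne_zero hlam hE1)
        (derivative_mem_degreeLT hr) fun f hf => ?_
      rw [hE.raiseIndex_derivative_mul]
      exact h _ (adjointDerivative_mem_degreeLT lam hf)
    obtain ⟨c, rfl⟩ : ∃ c, r = C c :=
      ⟨_, eq_C_of_natDegree_eq_zero (derivative_eq_zero.1 hderiv)⟩
    have h1 := h 1 (mem_degreeLT.2 (degree_one_le.trans_lt (by exact_mod_cast n.succ_pos)))
    rw [map_C_mul, mul_eq_zero, or_iff_left hE1] at h1
    rw [h1, C_0]

theorem adjointDerivative_derivative (hE : IsGegenbauer E lam) (hlam : -(1 / 2) < lam)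
    (hE1 : E 1 ≠ 0) {n : ℕ} {g : ℝ[X]} (hg : IsOrthogonalPoly E (n + 1) g) :
    adjointDerivative lam (derivative g) = C ((n + 1) * (n + 1 + 2 * lam)) * g := by
  rw [← sub_eq_zero]
  refine hE.eq_zero_of_forall_map_mul_eq_zero hlam hE1 (n := n + 1) ?_ fun f hf => ?_
  · rw [mem_degreeLT_iff_coeff]
    have hcoeff := mem_degreeLT_iff_coeff.1 hg.mem_degreeLT
    rintro (_ | k) hk
    · omega
    · rw [coeff_sub, coeff_adjointDerivative_succ, coeff_C_mul, coeff_derivative, coeff_derivative,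
        hcoeff (k + 2 + 1) (by omega)]
      obtain rfl | hlt := (Nat.le_of_succ_le_succ hk).eq_or_lt
      · ring
      · rw [hcoeff (k + 1) (by omega)]
        ring
  · rw [sub_mul, map_sub, mul_assoc, map_C_mul, hg.map_mul_eq_zero f hf, mul_comm _ f,
      ← hE.raiseIndex_derivative_mul, mul_comm, hE.raiseIndex_derivative_mul,
      hg.map_mul_eq_zero _ (adjointDerivative_mem_degreeLT lam (derivative_mem_degreeLT hf))]
    ring

theorem eval_one_derivative (hE : IsGegenbauer E lam) (hlam : -(1 / 2) < lam) (hE1 : E 1 ≠ 0)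
    {n : ℕ} {g : ℝ[X]} (hg : IsOrthogonalPoly E (n + 1) g) :
    (2 * lam + 1) * (derivative g).eval 1 = (n + 1) * (n + 1 + 2 * lam) * g.eval 1 := by
  rw [← eval_one_adjointDerivative, hE.adjointDerivative_derivative hlam hE1 hg, eval_C_mul]

theorem raiseIndex_derivative_mul_self (hE : IsGegenbauer E lam) (hlam : -(1 / 2) < lam)
    (hE1 : E 1 ≠ 0) {n : ℕ} {g : ℝ[X]} (hg : IsOrthogonalPoly E (n + 1) g) :
    raiseIndex E (derivative g * derivative g) = (n + 1) * (n + 1 + 2 * lam) * E (g * g) := by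
  rw [hE.raiseIndex_derivative_mul, hE.adjointDerivative_derivative hlam hE1 hg, mul_left_comm,
    map_C_mul]

theorem eval_one_sq_mul_map_one (hE : IsGegenbauer E lam) (hlam : -(1 / 2) < lam)
    (hE1 : E 1 ≠ 0) {n : ℕ} {g : ℝ[X]} (hg : IsOrthogonalPoly E n g) :
    g.eval 1 ^ 2 * E 1 * (n.factorial * poch(n + 2 * lam, n)) =
      E (g * g) * poch(2 * lam + 1, 2 * n) := by
  induction n generalizing E lam g with
  | zero =>
    obtain ⟨c, rfl⟩ : ∃ c, g = C c := ⟨_, eq_C_of_degree_le_zero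
      (Nat.WithBot.lt_one_iff_le_zero.1 (by simpa using mem_degreeLT.1 hg.mem_degreeLT))⟩
    have h := map_C_mul E (c * c) 1
    rw [mul_one, C_mul] at h
    simp [h, sq]
  | succ n ih =>
    have hind := ih hE.raise (by linarith) (hE.raiseIndex_one_ne_zero hlam hE1)
      (hE.isOrthogonalPoly_derivative hg)
    rw [hE.raiseIndex_derivative_mul_self hlam hE1 hg] at hind
    have heval := hE.eval_one_derivative hlam hE1 hg
    have hpoch : poch((n + 1 : ℕ) + 2 * lam, n + 1) =
        (n + 1 + 2 * lam) * poch(n + 2 * (lam + 1), n) := by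
      rw [ascPochhammer_succ_eval_left]
      push_cast
      ring_nf
    have hpoch' : poch(2 * lam + 1, 2 * (n + 1)) =
        (2 * lam + 1) * ((2 * lam + 2) * poch(2 * (lam + 1) + 1, 2 * n)) := by
      rw [mul_add_one, ascPochhammer_succ_eval_left, ascPochhammer_succ_eval_left]
      ring_nf
    rw [hpoch, hpoch', Nat.factorial_succ]
    push_cast
    set a := (derivative g).eval 1
    set P := (n.factorial : ℝ) * poch(n + 2 * (lam + 1), n)
    set N := ((n : ℝ) + 1) * (n + 1 + 2 * lam) with hN
    have hN0 : N ≠ 0 := (mul_pos (by positivity) (by linarith [(n.cast_nonneg : (0 : ℝ) ≤ n)])).ne'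
    refine mul_left_cancel₀ (mul_ne_zero hN0 (show 2 * lam + 1 ≠ 0 by linarith)) ?_
    calc _ = (N * g.eval 1) ^ 2 * ((2 * lam + 1) * E 1) * P := by rw [hN]; ring
      _ = (2 * lam + 1) ^ 2 * (2 * lam + 2) * (a ^ 2 * raiseIndex E 1 * P) := by
        rw [← heval, ← hE.raiseIndex_one]; ring
      _ = _ := by rw [hind, hN]; ring

theorem eval_one_sq_mul_map_one_le (hE : IsGegenbauer E lam) (hlam : 0 ≤ lam) (hE1 : E 1 ≠ 0)
    {n : ℕ} (hn : 1 ≤ n) {g : ℝ[X]} (hg : IsOrthogonalPoly E n g) (hg0 : 0 ≤ E (g * g)) :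
    g.eval 1 ^ 2 * E 1 ≤
      (2 * lam + 2) * Real.exp (2 * lam) * (n : ℝ) ^ (2 * lam) * E (g * g) := by
  have hpos : 0 < n.factorial * poch(n + 2 * lam, n) :=
    mul_pos (by positivity) (ascPochhammer_pos _ _ (by positivity))
  refine le_of_mul_le_mul_right ?_ hpos
  calc _ = E (g * g) * poch(2 * lam + 1, 2 * n) :=
        hE.eval_one_sq_mul_map_one (by linarith) hE1 hg
    _ ≤ E (g * g) * ((2 * lam + 2) * Real.exp (2 * lam) * (n : ℝ) ^ (2 * lam) *
          (n.factorial * poch(n + 2 * lam, n))) := by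
      gcongr
      exact ascPochhammer_eval_add_one_two_mul_le (by positivity) hn
    _ = _ := by ring

end IsGegenbauer

end Gegenbauer

section Integrals

open Set Real

theorem Gamma_add_natCast {x : ℝ} (hx : 0 < x) (n : ℕ) :
    Gamma (x + n) = poch(x, n) * Gamma x := by
  induction n with
  | zero => simp
  | succ n ih =>
    rw [ascPochhammer_succ_eval, Nat.cast_succ, ← add_assoc, Gamma_add_one (by positivity), ih]
    ring

theorem integral_eq_zero_of_neg_eq_neg {G : Type*} [MeasurableSpace G] [AddGroup G]
    [MeasurableNeg G] {μ : Measure G} [μ.IsNegInvariant] {f : G → ℝ} (hf : ∀ x, f (-x) = -f x) :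
    ∫ x, f x ∂μ = 0 := by
  have h := integral_neg_eq_self f μ
  simp only [hf, integral_neg] at h
  exact self_eq_neg.1 h.symm

theorem integral_rpow_mul_one_sub_rpow {α β : ℝ} (hα : 0 < α) (hβ : 0 < β) :
    ∫ u in Ioo (0 : ℝ) 1, u ^ (α - 1) * (1 - u) ^ (β - 1) =
      Gamma α * Gamma β / Gamma (α + β) := by
  have h := ProbabilityTheory.beta_eq_betaIntegralReal α β hα hβ
  rw [ProbabilityTheory.beta] at h
  rw [h, Complex.betaIntegral, intervalIntegral.integral_of_le zero_le_one,
    ← integral_Ioc_eq_integral_Ioo]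
  have hcast : ∫ x in Ioc (0 : ℝ) 1, (x : ℂ) ^ ((α : ℂ) - 1) * (1 - (x : ℂ)) ^ ((β : ℂ) - 1) =
      ∫ x in Ioc (0 : ℝ) 1, ((x ^ (α - 1) * (1 - x) ^ (β - 1) : ℝ) : ℂ) := by
    refine setIntegral_congr_fun measurableSet_Ioc fun x hx => ?_
    rw [Complex.ofReal_mul, Complex.ofReal_cpow hx.1.le, Complex.ofReal_cpow (by linarith [hx.2])]
    push_cast
    rfl
  rw [hcast, integral_complex_ofReal, Complex.ofReal_re]

theorem image_sq_Ioo_zero_one : (fun r : ℝ => r ^ 2) '' Ioo 0 1 = Ioo 0 1 := by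
  ext u
  constructor
  · rintro ⟨r, ⟨hr0, hr1⟩, rfl⟩
    exact ⟨by positivity, pow_lt_one₀ hr0.le hr1 two_ne_zero⟩
  · rintro ⟨hu0, hu1⟩
    exact ⟨√u, ⟨sqrt_pos.2 hu0, (sqrt_lt' one_pos).2 (by rwa [one_pow])⟩, sq_sqrt hu0.le⟩

theorem integral_rpow_mul_one_sub_sq_rpow {α β : ℝ} (hα : 0 < α) (hβ : 0 < β) :
    ∫ r in Ioo (0 : ℝ) 1, r ^ (2 * α - 1) * (1 - r ^ 2) ^ (β - 1) =
      Gamma α * Gamma β / (2 * Gamma (α + β)) := by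
  have hsubst := integral_image_eq_integral_abs_deriv_smul
    (s := Ioo (0 : ℝ) 1) measurableSet_Ioo
    (fun r _ => (hasDerivAt_pow 2 r).hasDerivWithinAt)
    (fun r hr s hs => (pow_left_inj₀ hr.1.le hs.1.le two_ne_zero).1)
    (fun u => u ^ (α - 1) * (1 - u) ^ (β - 1))
  rw [image_sq_Ioo_zero_one, integral_rpow_mul_one_sub_rpow hα hβ] at hsubst
  rw [mul_comm 2 (Gamma _), ← div_div, hsubst, eq_div_iff two_ne_zero, ← integral_mul_const]
  refine setIntegral_congr_fun measurableSet_Ioo fun r hr => ?_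
  have hpow : r ^ (2 * α - 1) = r * (r ^ 2) ^ (α - 1) := by
    rw [← rpow_two, ← rpow_mul hr.1.le, mul_comm r, ← rpow_add_one hr.1.ne']
    ring_nf
  simp only [hpow, Nat.cast_ofNat, Nat.add_one_sub_one, pow_one, smul_eq_mul]
  rw [abs_of_pos (by linarith [hr.1])]
  ring

theorem integral_homogeneous_mul_fun_norm {E : Type*} [NormedAddCommGroup E] [NormedSpace ℝ E]
    [Nontrivial E] [FiniteDimensional ℝ E] [MeasurableSpace E] [BorelSpace E] (μ : Measure E)
    [μ.IsAddHaarMeasure] {h : E → ℝ} {m : ℕ}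
    (hh : ∀ (r : ℝ) (y : E), 0 < r → h (r • y) = r ^ m * h y) (f : ℝ → ℝ) :
    ∫ y, h y * f ‖y‖ ∂μ = (∫ ω : Metric.sphere (0 : E) 1, h ω ∂μ.toSphere) *
      ∫ r in Ioi (0 : ℝ), r ^ (Module.finrank ℝ E - 1) * (r ^ m * f r) := by
  calc ∫ y, h y * f ‖y‖ ∂μ
      = ∫ y : ({0}ᶜ : Set E), h y.1 * f ‖y.1‖ ∂(μ.comap (↑)) := by
        rw [integral_subtype_comap (measurableSet_singleton _).compl fun y => h y * f ‖y‖,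
          restrict_compl_singleton]
    _ = ∫ x, h (x.1 : E) * ((x.2 : ℝ) ^ m * f x.2)
          ∂μ.toSphere.prod (.volumeIoiPow (Module.finrank ℝ E - 1)) := by
        rw [← μ.measurePreserving_homeomorphUnitSphereProd.integral_comp
          (Homeomorph.measurableEmbedding _)]
        refine integral_congr_ae (.of_forall fun y => ?_)
        have hy : 0 < ‖y.1‖ := norm_pos_iff.2 y.2
        simp only [homeomorphUnitSphereProd_apply_fst_coe, homeomorphUnitSphereProd_apply_snd_coe]
        rw [hh _ _ (inv_pos.2 hy), inv_pow]
        field_simp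
    _ = (∫ ω : Metric.sphere (0 : E) 1, h ω ∂μ.toSphere) *
          ∫ r : Ioi (0 : ℝ), (r : ℝ) ^ m * f r ∂(.volumeIoiPow (Module.finrank ℝ E - 1)) :=
        integral_prod_mul (fun ω : Metric.sphere (0 : E) 1 => h ω)
          (fun r : Ioi (0 : ℝ) => (r : ℝ) ^ m * f r)
    _ = _ := by
        congr 1
        simp only [Measure.volumeIoiPow, ENNReal.ofReal]
        rw [integral_withDensity_eq_integral_smul
            (measurable_subtype_coe.pow_const _).real_toNNReal,
          integral_subtype_comap measurableSet_Ioi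
            fun r : ℝ => Real.toNNReal (r ^ (Module.finrank ℝ E - 1)) • (r ^ m * f r)]
        refine setIntegral_congr_fun measurableSet_Ioi fun r hr => ?_
        simp only [NNReal.smul_def, smul_eq_mul]
        rw [Real.coe_toNNReal _ (pow_nonneg (le_of_lt hr) _)]

theorem integral_fun_inner_norm_eq_of_norm_eq {E : Type*} [NormedAddCommGroup E]
    [InnerProductSpace ℝ E] [FiniteDimensional ℝ E] [MeasurableSpace E] [BorelSpace E] {a b : E}
    (hab : ‖a‖ = ‖b‖) (g : ℝ → ℝ → ℝ) :
    ∫ y : E, g (inner ℝ a y) ‖y‖ = ∫ y : E, g (inner ℝ b y) ‖y‖ := by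
  set R := (Submodule.span ℝ {a - b})ᗮ.reflection
  have hR : R a = b := Submodule.reflection_sub hab
  rw [← R.measurePreserving.integral_comp R.toHomeomorph.measurableEmbedding
    fun y => g (inner ℝ b y) ‖y‖]
  simp only [← hR, LinearIsometryEquiv.inner_map_map, LinearIsometryEquiv.norm_map]

/-- The moment of order `l` of the probability density `exp (-x ^ 2) / √π`. -/
def gaussianMoment (l : ℕ) : ℝ := if Even l then poch(1 / 2, l / 2) else 0

theorem gaussianMoment_two_mul (i : ℕ) : gaussianMoment (2 * i) = poch(1 / 2, i) := by
  simp [gaussianMoment]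

theorem gaussianMoment_of_odd {l : ℕ} (hl : Odd l) : gaussianMoment l = 0 :=
  if_neg (Nat.not_even_iff_odd.2 hl)

theorem gaussianMoment_zero : gaussianMoment 0 = 1 := by simp [gaussianMoment]

theorem integral_pow_mul_exp_neg_sq_Ioi (l : ℕ) :
    ∫ r in Ioi (0 : ℝ), r ^ l * exp (-r ^ 2) = 1 / 2 * Gamma ((l + 1) / 2) := by
  rw [← integral_rpow_mul_exp_neg_rpow two_pos
    (neg_one_lt_zero.trans_le l.cast_nonneg)]
  simp only [rpow_natCast, rpow_two]

theorem integral_pow_mul_exp_neg_sq (l : ℕ) :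
    ∫ x : ℝ, x ^ l * exp (-x ^ 2) = gaussianMoment l * √π := by
  obtain ⟨i, rfl | rfl⟩ := Nat.even_or_odd' l
  · have habs := integral_comp_abs (f := fun x : ℝ => x ^ (2 * i) * exp (-x ^ 2))
    simp only [sq_abs, (even_two_mul i).pow_abs] at habs
    rw [habs, integral_pow_mul_exp_neg_sq_Ioi, gaussianMoment_two_mul, ← Gamma_one_half_eq,
      ← Gamma_add_natCast one_half_pos]
    push_cast
    ring_nf
  · rw [gaussianMoment_of_odd (odd_two_mul_add_one i), zero_mul]
    exact integral_eq_zero_of_neg_eq_neg fun x => by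
      rw [(odd_two_mul_add_one i).neg_pow, neg_sq, neg_mul]

variable {d : ℕ}

theorem integrable_pow_mul_exp_neg_sq (l : ℕ) : Integrable fun x : ℝ => x ^ l * exp (-x ^ 2) := by
  simpa using integrable_rpow_mul_exp_neg_mul_sq one_pos (neg_one_lt_zero.trans_le l.cast_nonneg)

theorem prod_apply_pow_mul_exp_neg_norm_sq (l : Fin d → ℕ) (y : EuclideanSpace ℝ (Fin d)) :
    (∏ k, y k ^ l k) * exp (-‖y‖ ^ 2) = ∏ k, y k ^ l k * exp (-y k ^ 2) := by
  rw [Finset.prod_mul_distrib, ← Real.exp_sum, EuclideanSpace.real_norm_sq_eq,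
    Finset.sum_neg_distrib]

theorem integrable_prod_apply_pow_mul_exp_neg_norm_sq (l : Fin d → ℕ) :
    Integrable fun y : EuclideanSpace ℝ (Fin d) => (∏ k, y k ^ l k) * exp (-‖y‖ ^ 2) := by
  simp only [prod_apply_pow_mul_exp_neg_norm_sq]
  exact ((PiLp.volume_preserving_ofLp (Fin d)).integrable_comp_emb
    (MeasurableEquiv.toLp 2 (Fin d → ℝ)).symm.measurableEmbedding).2
    (Integrable.fintype_prod fun k => integrable_pow_mul_exp_neg_sq (l k))

theorem integral_prod_apply_pow_mul_exp_neg_norm_sq (l : Fin d → ℕ) :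
    ∫ y : EuclideanSpace ℝ (Fin d), (∏ k, y k ^ l k) * exp (-‖y‖ ^ 2) =
      (∏ k, gaussianMoment (l k)) * √π ^ d := by
  simp only [prod_apply_pow_mul_exp_neg_norm_sq]
  rw [(PiLp.volume_preserving_ofLp (Fin d)).integral_comp
      (MeasurableEquiv.toLp 2 (Fin d → ℝ)).symm.measurableEmbedding
      fun x : Fin d → ℝ => ∏ k, x k ^ l k * exp (-x k ^ 2),
    integral_fintype_prod_volume_eq_prod fun (k : Fin d) (t : ℝ) => t ^ l k * exp (-t ^ 2)]
  simp only [integral_pow_mul_exp_neg_sq, Finset.prod_mul_distrib, Finset.prod_const,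
    Finset.card_univ, Fintype.card_fin]

variable [NeZero d]

theorem integral_inner_pow_mul_exp_neg_norm_sq (a : EuclideanSpace ℝ (Fin d)) (l : ℕ) :
    ∫ y : EuclideanSpace ℝ (Fin d), inner ℝ a y ^ l * exp (-‖y‖ ^ 2) =
      ‖a‖ ^ l * (gaussianMoment l * √π ^ d) := by
  have hnorm : ‖a‖ = ‖(EuclideanSpace.single 0 ‖a‖ : EuclideanSpace ℝ (Fin d))‖ := by simp
  have hcoord := integral_prod_apply_pow_mul_exp_neg_norm_sq (Pi.single (0 : Fin d) l)
  simp only [Pi.single_apply, pow_ite, pow_zero, apply_ite gaussianMoment, gaussianMoment_zero,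
    Finset.prod_ite_eq', Finset.mem_univ, if_true] at hcoord
  rw [integral_fun_inner_norm_eq_of_norm_eq hnorm fun s r => s ^ l * exp (-r ^ 2), ← hcoord,
    ← integral_const_mul]
  simp [EuclideanSpace.inner_single_left, mul_pow, mul_assoc]

/-- The rotation invariance of the planar Gaussian law, read off from moments. -/
theorem sum_choose_mul_gaussianMoment (α β : ℝ) (M : ℕ) :
    ∑ l ∈ Finset.range (M + 1), (M.choose l : ℝ) *
      (α ^ l * gaussianMoment l * (β ^ (M - l) * gaussianMoment (M - l))) =
      √(α ^ 2 + β ^ 2) ^ M * gaussianMoment M := by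
  have h := integral_inner_pow_mul_exp_neg_norm_sq (!₂[α, β] : EuclideanSpace ℝ (Fin 2)) M
  have hexp : ∀ y : EuclideanSpace ℝ (Fin 2), inner ℝ !₂[α, β] y ^ M * exp (-‖y‖ ^ 2) =
      ∑ l ∈ Finset.range (M + 1), (M.choose l : ℝ) * (α ^ l * β ^ (M - l)) *
        ((∏ k, y k ^ (![l, M - l] : Fin 2 → ℕ) k) * exp (-‖y‖ ^ 2)) := fun y => by
    rw [PiLp.inner_apply, Fin.sum_univ_two, add_pow, Finset.sum_mul]
    refine Finset.sum_congr rfl fun l _ => ?_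
    simp only [Fin.prod_univ_two, RCLike.inner_apply, conj_trivial, mul_pow, Matrix.cons_val_zero,
      Matrix.cons_val_one]
    ring
  simp only [hexp] at h
  rw [integral_finsetSum _ fun l _ =>
    (integrable_prod_apply_pow_mul_exp_neg_norm_sq _).const_mul _] at h
  simp only [integral_const_mul, integral_prod_apply_pow_mul_exp_neg_norm_sq] at h
  simp only [Fin.prod_univ_two, Matrix.cons_val_zero, Matrix.cons_val_one, EuclideanSpace.norm_eq,
    Fin.sum_univ_two, norm_eq_abs, sq_abs, ← mul_assoc, ← Finset.sum_mul] at h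
  rw [← mul_right_cancel₀ (by positivity) h]
  exact Finset.sum_congr rfl fun l _ => by ring

/-- The spherical factor of the polar decomposition is computed from the Gaussian case. -/
theorem integral_inner_pow_mul_fun_norm (a : EuclideanSpace ℝ (Fin d)) (l : ℕ) (f : ℝ → ℝ) :
    Gamma ((d + l) / 2) * ∫ y, inner ℝ a y ^ l * f ‖y‖ =
      2 * (‖a‖ ^ l * gaussianMoment l * √π ^ d) *
        ∫ r in Ioi (0 : ℝ), r ^ (d - 1) * (r ^ l * f r) := by
  have hhom : ∀ (r : ℝ) (y : EuclideanSpace ℝ (Fin d)), 0 < r →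
      inner ℝ a (r • y) ^ l = r ^ l * inner ℝ a y ^ l := fun r y _ => by
    rw [inner_smul_right, mul_pow]
  have hgauss := integral_homogeneous_mul_fun_norm (h := fun y => inner ℝ a y ^ l) volume hhom
    fun r => exp (-r ^ 2)
  have hpolar := integral_homogeneous_mul_fun_norm (h := fun y => inner ℝ a y ^ l) volume hhom f
  simp only [← mul_assoc, ← pow_add, finrank_euclideanSpace_fin] at hgauss hpolar ⊢
  rw [integral_inner_pow_mul_exp_neg_norm_sq, integral_pow_mul_exp_neg_sq_Ioi, Nat.cast_add,
    Nat.cast_pred (NeZero.pos d), show (d - 1 + l + 1 : ℝ) = d + l by ring] at hgauss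
  rw [hpolar]
  linear_combination (-2 * ∫ r in Ioi (0 : ℝ), r ^ (d - 1 + l) * f r) * hgauss

theorem integral_ball_weight_radial {κ : ℝ} (hκ : -(1 / 2) < κ) (l j : ℕ) :
    ∫ r in Ioi (0 : ℝ), r ^ (d - 1) * (r ^ l *
      (Iic 1).indicator (fun r : ℝ => (1 - r ^ 2) ^ j * (1 - r ^ 2) ^ (κ - 1 / 2)) r) =
      Gamma ((d + l) / 2) * Gamma (κ + 1 / 2 + j) /
        (2 * Gamma ((d + l) / 2 + (κ + 1 / 2 + j))) := by
  have hd : (0 : ℝ) < d := Nat.cast_pos.2 (NeZero.pos d)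
  have hj : (0 : ℝ) < κ + 1 / 2 + j := add_pos_of_pos_of_nonneg (by linarith) j.cast_nonneg
  rw [← integral_rpow_mul_one_sub_sq_rpow (by positivity) hj]
  have hind : ∀ r : ℝ, r ^ (d - 1) * (r ^ l *
      (Iic 1).indicator (fun r : ℝ => (1 - r ^ 2) ^ j * (1 - r ^ 2) ^ (κ - 1 / 2)) r) =
      (Iic 1).indicator (fun r : ℝ => r ^ (d - 1) * (r ^ l *
        ((1 - r ^ 2) ^ j * (1 - r ^ 2) ^ (κ - 1 / 2)))) r := fun r => by
    simp [indicator]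
  simp only [hind]
  rw [setIntegral_indicator measurableSet_Iic, Ioi_inter_Iic, integral_Ioc_eq_integral_Ioo]
  refine setIntegral_congr_fun measurableSet_Ioo fun r hr => ?_
  have hr1 : 0 < 1 - r ^ 2 := sub_pos.2 (pow_lt_one₀ hr.1.le hr.2 two_ne_zero)
  rw [← rpow_natCast (1 - r ^ 2), ← rpow_add hr1, ← mul_assoc, ← pow_add, ← rpow_natCast,
    Nat.cast_add, Nat.cast_pred (NeZero.pos d)]
  ring_nf

end Integrals

section BallWeight

open Set Real

variable {d : ℕ}

theorem integral_weightMeasure (κ : ℝ) (f : EuclideanSpace ℝ (Fin d) → ℝ) :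
    ∫ y, f y ∂(weightMeasure d κ) =
      ∫ y in unitBall d, f y * (1 - ‖y‖ ^ 2) ^ (κ - 1 / 2) := by
  rw [weightMeasure, integral_withDensity_eq_integral_toReal_smul (by fun_prop) (by simp)]
  refine setIntegral_congr_fun Metric.isClosed_closedBall.measurableSet fun y hy => ?_
  have hy1 : ‖y‖ ^ 2 ≤ 1 := pow_le_one₀ (norm_nonneg y) (mem_closedBall_zero_iff.1 hy)
  rw [ENNReal.toReal_ofReal (rpow_nonneg (by linarith) _), smul_eq_mul, mul_comm]

theorem integral_F (κ : ℝ) (f : EuclideanSpace ℝ (Fin d) → ℝ) :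
    ∫ y, f y ∂(F d κ) = (∫ _, (1 : ℝ) ∂(weightMeasure d κ))⁻¹ * ∫ y, f y ∂(weightMeasure d κ) := by
  rw [F, integral_smul_measure]
  simp [Measure.real]

variable [NeZero d] {κ : ℝ}

theorem integral_weightMeasure_inner_pow_mul (hκ : -(1 / 2) < κ) (a : EuclideanSpace ℝ (Fin d))
    (l j : ℕ) :
    ∫ y, inner ℝ a y ^ l * (1 - ‖y‖ ^ 2) ^ j ∂(weightMeasure d κ) =
      ‖a‖ ^ l * gaussianMoment l * √π ^ d *
        (Gamma (κ + 1 / 2 + j) / Gamma ((d + l) / 2 + (κ + 1 / 2 + j))) := by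
  have hd : (0 : ℝ) < d := Nat.cast_pos.2 (NeZero.pos d)
  have hpolar := integral_inner_pow_mul_fun_norm a l
    ((Iic 1).indicator fun r : ℝ => (1 - r ^ 2) ^ j * (1 - r ^ 2) ^ (κ - 1 / 2))
  rw [integral_ball_weight_radial hκ] at hpolar
  rw [integral_weightMeasure, ← integral_indicator Metric.isClosed_closedBall.measurableSet]
  have hball : ∀ y : EuclideanSpace ℝ (Fin d),
      (unitBall d).indicator
        (fun y => inner ℝ a y ^ l * (1 - ‖y‖ ^ 2) ^ j * (1 - ‖y‖ ^ 2) ^ (κ - 1 / 2)) y =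
      inner ℝ a y ^ l * (Iic 1).indicator
        (fun r : ℝ => (1 - r ^ 2) ^ j * (1 - r ^ 2) ^ (κ - 1 / 2)) ‖y‖ := fun y => by
    simp [indicator, mul_assoc]
  simp only [hball]
  refine mul_left_cancel₀ (Gamma_pos_of_pos (show 0 < ((d : ℝ) + l) / 2 by positivity)).ne' ?_
  rw [hpolar, ← div_div]
  ring

theorem integral_F_inner_pow_mul (hκ : -(1 / 2) < κ) (a : EuclideanSpace ℝ (Fin d)) (l j : ℕ) :
    ∫ y, inner ℝ a y ^ l * (1 - ‖y‖ ^ 2) ^ j ∂(F d κ) =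
      ‖a‖ ^ l * gaussianMoment l * poch(κ + 1 / 2, j) /
        poch(κ + 1 / 2 + d / 2, l / 2 + j) := by
  have hκ' : 0 < κ + 1 / 2 := by linarith
  have hmass := integral_weightMeasure_inner_pow_mul hκ (0 : EuclideanSpace ℝ (Fin d)) 0 0
  simp only [pow_zero, mul_one, one_mul, gaussianMoment_zero, Nat.cast_zero, add_zero] at hmass
  rw [integral_F, hmass, integral_weightMeasure_inner_pow_mul hκ, Gamma_add_natCast hκ']
  obtain ⟨i, rfl | rfl⟩ := Nat.even_or_odd' l
  · have hΓ : Gamma (((d : ℝ) + (2 * i : ℕ)) / 2 + (κ + 1 / 2 + j)) =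
        poch(κ + 1 / 2 + d / 2, 2 * i / 2 + j) * Gamma (κ + 1 / 2 + d / 2) := by
      rw [← Gamma_add_natCast (by positivity), Nat.mul_div_cancel_left _ two_pos]
      push_cast
      ring_nf
    have hΓd : 0 < Gamma (κ + 1 / 2 + d / 2) := Gamma_pos_of_pos (by positivity)
    have hΓκ : 0 < Gamma (κ + 1 / 2) := Gamma_pos_of_pos hκ'
    rw [hΓ, add_comm ((d : ℝ) / 2)]
    generalize Gamma (κ + 1 / 2) = A at hΓκ ⊢
    generalize Gamma (κ + 1 / 2 + d / 2) = B at hΓd ⊢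
    field_simp
  · rw [gaussianMoment_of_odd (odd_two_mul_add_one i)]
    ring

theorem isProbabilityMeasure_F (hκ : -(1 / 2) < κ) : IsProbabilityMeasure (F d κ) := by
  have h := integral_F_inner_pow_mul hκ (0 : EuclideanSpace ℝ (Fin d)) 0 0
  simp only [pow_zero, mul_one, gaussianMoment_zero, Nat.zero_div, add_zero, ascPochhammer_zero,
    Polynomial.eval_one, div_one, integral_const, smul_eq_mul, Measure.real] at h
  exact ⟨(ENNReal.toReal_eq_one_iff _).1 h⟩

end BallWeight

section GegenbauerLaw

open Set Real

variable {κ lam : ℝ}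

/-- The moment of order `l` of the Gegenbauer law of index `λ`. -/
def gegenbauerMoment (lam : ℝ) (l : ℕ) : ℝ := gaussianMoment l / poch(lam + 1, l / 2)

theorem gegenbauerMoment_of_odd (lam : ℝ) {l : ℕ} (hl : Odd l) : gegenbauerMoment lam l = 0 := by
  rw [gegenbauerMoment, gaussianMoment_of_odd hl, zero_div]

theorem integral_apply_zero_pow_F (hκ : -(1 / 2) < κ) (l : ℕ) :
    ∫ y, y 0 ^ l ∂(F 1 κ) = gegenbauerMoment κ l := by
  have h := integral_F_inner_pow_mul hκ (EuclideanSpace.single (0 : Fin 1) 1) l 0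
  simp only [EuclideanSpace.inner_single_left, map_one, one_mul, pow_zero, mul_one,
    PiLp.norm_single, norm_one, one_pow, ascPochhammer_zero, Polynomial.eval_one,
    add_zero, Nat.cast_one] at h
  rw [h, gegenbauerMoment, add_assoc, add_halves]

/-- The Gegenbauer law of index `λ ≥ -1/2`, the probability measure on `[-1, 1]` with density
proportional to `(1 - t²)^(λ - 1/2)`. This density is not integrable at `λ = -1/2`, where the law is
defined as the weak limit, which is the Rademacher law. -/
def gegenbauerLaw (lam : ℝ) : Measure ℝ :=
  if lam = -(1 / 2) then (2⁻¹ : ENNReal) • (Measure.dirac 1 + Measure.dirac (-1))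
  else (F 1 lam).map fun y => y 0

instance isFiniteMeasure_gegenbauerLaw (lam : ℝ) : IsFiniteMeasure (gegenbauerLaw lam) := by
  rw [gegenbauerLaw]
  split_ifs
  · exact Measure.smul_finite _ (by simp)
  · infer_instance

theorem ae_abs_le_one_gegenbauerLaw (lam : ℝ) : ∀ᵐ t ∂(gegenbauerLaw lam), |t| ≤ 1 := by
  rw [gegenbauerLaw]
  split_ifs
  · refine Measure.ae_smul_measure ?_ _
    rw [ae_add_measure_iff]
    simp [ae_dirac_eq]
  · rw [ae_map_iff (by fun_prop) (measurableSet_le (by fun_prop) (by fun_prop))]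
    filter_upwards [ae_mem_unitBall 1 lam] with y hy
    exact (PiLp.norm_apply_le y 0).trans (mem_closedBall_zero_iff.1 hy)

theorem integrable_gegenbauerLaw_of_continuous {f : ℝ → ℝ} (hf : Continuous f) :
    Integrable f (gegenbauerLaw lam) := by
  obtain ⟨M, hM⟩ := (isCompact_Icc (a := (-1 : ℝ)) (b := 1)).exists_bound_of_continuousOn
    hf.continuousOn
  refine Integrable.of_bound hf.aestronglyMeasurable M ?_
  filter_upwards [ae_abs_le_one_gegenbauerLaw lam] with t ht using hM t (abs_le.1 ht)

theorem integral_pow_gegenbauerLaw (hlam : -(1 / 2) ≤ lam) (l : ℕ) :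
    ∫ t, t ^ l ∂(gegenbauerLaw lam) = gegenbauerMoment lam l := by
  rw [gegenbauerLaw]
  split_ifs with h
  · rw [h, integral_smul_measure, integral_add_measure (integrable_dirac (by simp))
      (integrable_dirac (by simp)), integral_dirac, integral_dirac, one_pow, ENNReal.toReal_inv,
      ENNReal.toReal_ofNat, smul_eq_mul]
    obtain ⟨i, rfl | rfl⟩ := Nat.even_or_odd' l
    · have hpos : 0 < poch(1 / 2, i) := ascPochhammer_pos _ _ one_half_pos
      rw [gegenbauerMoment, gaussianMoment_two_mul, Nat.mul_div_cancel_left _ two_pos,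
        show -(1 / 2) + 1 = (1 / 2 : ℝ) by norm_num, div_self hpos.ne',
        (even_two_mul i).neg_one_pow]
      norm_num
    · rw [gegenbauerMoment_of_odd _ (odd_two_mul_add_one i), (odd_two_mul_add_one i).neg_one_pow]
      norm_num
  · rw [integral_map (by fun_prop) (by fun_prop),
      integral_apply_zero_pow_F (lt_of_le_of_ne hlam (Ne.symm h))]

theorem isProbabilityMeasure_gegenbauerLaw (hlam : -(1 / 2) ≤ lam) :
    IsProbabilityMeasure (gegenbauerLaw lam) := by
  have h := integral_pow_gegenbauerLaw hlam 0
  simp only [pow_zero, gegenbauerMoment, gaussianMoment_zero, Nat.zero_div, ascPochhammer_zero,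
    Polynomial.eval_one, div_one, integral_const, smul_eq_mul, mul_one, Measure.real] at h
  exact ⟨(ENNReal.toReal_eq_one_iff _).1 h⟩

theorem integral_add_mul_pow_gegenbauerLaw (hlam : -(1 / 2) ≤ lam) (u b h : ℝ) (p : ℕ) :
    ∫ t, (u + b * (t * h)) ^ p ∂(gegenbauerLaw lam) =
      ∑ l ∈ Finset.range (p + 1), (p.choose l * b ^ (p - l) * gegenbauerMoment lam (p - l)) *
        (u ^ l * (h ^ 2) ^ ((p - l) / 2)) := by
  simp only [add_pow]
  rw [integral_finsetSum _ fun l _ => integrable_gegenbauerLaw_of_continuous (by fun_prop)]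
  refine Finset.sum_congr rfl fun l _ => ?_
  have hterm : ∀ t : ℝ, u ^ l * (b * (t * h)) ^ (p - l) * (p.choose l : ℝ) =
      (u ^ l * b ^ (p - l) * h ^ (p - l) * p.choose l) * t ^ (p - l) := fun t => by ring
  simp only [hterm]
  rw [integral_const_mul, integral_pow_gegenbauerLaw hlam]
  obtain ⟨i, hi | hi⟩ := Nat.even_or_odd' (p - l)
  · rw [hi, Nat.mul_div_cancel_left _ two_pos, ← pow_mul]
    ring
  · rw [hi, gegenbauerMoment_of_odd _ (odd_two_mul_add_one i)]
    ring

end GegenbauerLaw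

section Lift

open Real

variable {d : ℕ} {ν : ℝ}

/-- The height of the point of the upper unit hemisphere above a point of the unit ball. -/
def height (y : EuclideanSpace ℝ (Fin d)) : ℝ := √(1 - ‖y‖ ^ 2)

/-- The point above `y` at `t` times the height of the unit hemisphere of `ℝᵈ × ℝ`. -/
def lift (y : EuclideanSpace ℝ (Fin d)) (t : ℝ) : WithLp 2 (EuclideanSpace ℝ (Fin d) × ℝ) :=
  WithLp.toLp 2 (y, t * height y)

/-- The law of `(Y, t)` for independent `Y` of law `F_ν` and `t` of the Gegenbauer law of index
`ν - 1/2`; its image under `lift` has rotation invariant moments. -/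
def liftLaw (d : ℕ) (ν : ℝ) : Measure (EuclideanSpace ℝ (Fin d) × ℝ) :=
  (F d ν).prod (gegenbauerLaw (ν - 1 / 2))

instance isFiniteMeasure_liftLaw (d : ℕ) (ν : ℝ) : IsFiniteMeasure (liftLaw d ν) := by
  unfold liftLaw
  infer_instance

@[fun_prop]
theorem continuous_height : Continuous (height (d := d)) := by
  unfold height
  fun_prop

theorem height_sq {y : EuclideanSpace ℝ (Fin d)} (hy : ‖y‖ ≤ 1) : height y ^ 2 = 1 - ‖y‖ ^ 2 :=
  sq_sqrt (sub_nonneg.2 (pow_le_one₀ (norm_nonneg y) hy))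

theorem inner_lift (v : WithLp 2 (EuclideanSpace ℝ (Fin d) × ℝ)) (y : EuclideanSpace ℝ (Fin d))
    (t : ℝ) : inner ℝ v (lift y t) = inner ℝ v.fst y + v.snd * (t * height y) := by
  rw [WithLp.prod_inner_apply, mul_comm]
  rfl

theorem norm_lift_one {y : EuclideanSpace ℝ (Fin d)} (hy : ‖y‖ ≤ 1) : ‖lift y 1‖ = 1 := by
  rw [WithLp.prod_norm_eq_of_L2]
  simp [lift, height_sq hy]

@[fun_prop]
theorem continuous_inner_lift (v : WithLp 2 (EuclideanSpace ℝ (Fin d) × ℝ)) :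
    Continuous fun z : EuclideanSpace ℝ (Fin d) × ℝ => inner ℝ v (lift z.1 z.2) := by
  simp only [inner_lift]
  fun_prop

theorem integrable_liftLaw_of_continuous {f : EuclideanSpace ℝ (Fin d) × ℝ → ℝ}
    (hf : Continuous f) : Integrable f (liftLaw d ν) := by
  obtain ⟨M, hM⟩ := ((isCompact_closedBall (0 : EuclideanSpace ℝ (Fin d)) 1).prod
    (isCompact_Icc (a := (-1 : ℝ)) (b := 1))).exists_bound_of_continuousOn hf.continuousOn
  refine Integrable.of_bound hf.aestronglyMeasurable M ?_
  filter_upwards [Measure.quasiMeasurePreserving_fst.ae (ae_mem_unitBall d ν),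
    Measure.quasiMeasurePreserving_snd.ae (ae_abs_le_one_gegenbauerLaw _)] with z hz ht
  exact hM z ⟨hz, abs_le.1 ht⟩

variable [NeZero d]

theorem integral_inner_pow_mul_height_pow_mul_gegenbauerMoment (hν : 0 ≤ ν)
    (a : EuclideanSpace ℝ (Fin d)) (l k : ℕ) :
    (∫ y, inner ℝ a y ^ l * height y ^ k ∂(F d ν)) * gegenbauerMoment (ν - 1 / 2) k =
      ‖a‖ ^ l * gaussianMoment l * gaussianMoment k / poch(ν + (d + 1) / 2, (l + k) / 2) := by
  obtain ⟨j, rfl | rfl⟩ := Nat.even_or_odd' k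
  · have hheight : ∫ y, inner ℝ a y ^ l * height y ^ (2 * j) ∂(F d ν) =
        ∫ y, inner ℝ a y ^ l * (1 - ‖y‖ ^ 2) ^ j ∂(F d ν) := by
      refine integral_congr_ae ?_
      filter_upwards [ae_mem_unitBall d ν] with y hy
      rw [pow_mul, height_sq (mem_closedBall_zero_iff.1 hy)]
    have hpoch : 0 < poch(ν + 1 / 2, j) := ascPochhammer_pos _ _ (by positivity)
    rw [hheight, integral_F_inner_pow_mul (by linarith), gegenbauerMoment,
      show ν - 1 / 2 + 1 = ν + 1 / 2 by ring, show ν + 1 / 2 + d / 2 = ν + (d + 1) / 2 by ring,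
      Nat.mul_div_cancel_left _ two_pos, Nat.add_mul_div_left _ _ two_pos]
    generalize poch(ν + 1 / 2, j) = P at hpoch ⊢
    field_simp
  · have hodd := odd_two_mul_add_one j
    rw [gegenbauerMoment_of_odd _ hodd, gaussianMoment_of_odd hodd, mul_zero, mul_zero, zero_div]

theorem integral_inner_lift_pow (hν : 0 ≤ ν) (v : WithLp 2 (EuclideanSpace ℝ (Fin d) × ℝ))
    (M : ℕ) :
    ∫ z, inner ℝ v (lift z.1 z.2) ^ M ∂(liftLaw d ν) =
      ‖v‖ ^ M * gegenbauerMoment (ν + (d - 1) / 2) M := by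
  have hterm : ∀ l k : ℕ, ∫ z : EuclideanSpace ℝ (Fin d) × ℝ,
      inner ℝ v.fst z.1 ^ l * (v.snd * (z.2 * height z.1)) ^ k * (M.choose l : ℝ) ∂(liftLaw d ν) =
      (M.choose l : ℝ) * v.snd ^ k * (‖v.fst‖ ^ l * gaussianMoment l * gaussianMoment k /
        poch(ν + (d + 1) / 2, (l + k) / 2)) := by
    intro l k
    rw [← integral_inner_pow_mul_height_pow_mul_gegenbauerMoment hν,
      ← integral_pow_gegenbauerLaw (by linarith), ← integral_prod_mul, ← integral_const_mul]
    exact integral_congr_ae (.of_forall fun z => by ring)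
  simp only [inner_lift, add_pow]
  rw [integral_finsetSum _ fun l _ => integrable_liftLaw_of_continuous (by fun_prop),
    WithLp.prod_norm_eq_of_L2, norm_eq_abs v.snd, sq_abs, gegenbauerMoment, ← mul_div_assoc,
    ← sum_choose_mul_gaussianMoment, Finset.sum_div]
  refine Finset.sum_congr rfl fun l hl => ?_
  rw [hterm, Nat.add_sub_cancel' (Nat.le_of_lt_succ (Finset.mem_range.1 hl)),
    show ν + ((d : ℝ) - 1) / 2 + 1 = ν + (d + 1) / 2 by ring]
  ring

end Lift

section Polarization

theorem integral_add_mul_pow_eq_eval {Ω : Type*} [MeasurableSpace Ω] {P : Measure Ω} {u v : Ω → ℝ}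
    (hi : ∀ p k : ℕ, Integrable (fun z => u z ^ p * v z ^ k) P) (M : ℕ) (τ : ℝ) :
    ∫ z, (u z + τ * v z) ^ M ∂P =
      (∑ k ∈ Finset.range (M + 1), Polynomial.C ((M.choose k : ℝ) *
        ∫ z, u z ^ (M - k) * v z ^ k ∂P) * Polynomial.X ^ k).eval τ := by
  have hexp : ∀ z, (u z + τ * v z) ^ M = ∑ k ∈ Finset.range (M + 1),
      (M.choose k * τ ^ k) * (u z ^ (M - k) * v z ^ k) := fun z => by
    rw [add_comm, add_pow]
    exact Finset.sum_congr rfl fun k _ => by ring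
  simp only [hexp]
  rw [integral_finsetSum _ fun k _ => (hi _ _).const_mul _, Polynomial.eval_finsetSum]
  refine Finset.sum_congr rfl fun k _ => ?_
  rw [integral_const_mul, Polynomial.eval_C_mul, Polynomial.eval_pow, Polynomial.eval_X]
  ring

theorem integral_pow_mul_pow_eq {Ω₁ Ω₂ : Type*} [MeasurableSpace Ω₁] [MeasurableSpace Ω₂]
    {P₁ : Measure Ω₁} {P₂ : Measure Ω₂} {u₁ v₁ : Ω₁ → ℝ} {u₂ v₂ : Ω₂ → ℝ}
    (h₁ : ∀ p k : ℕ, Integrable (fun z => u₁ z ^ p * v₁ z ^ k) P₁)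
    (h₂ : ∀ p k : ℕ, Integrable (fun z => u₂ z ^ p * v₂ z ^ k) P₂)
    (h : ∀ (M : ℕ) (τ : ℝ), ∫ z, (u₁ z + τ * v₁ z) ^ M ∂P₁ = ∫ z, (u₂ z + τ * v₂ z) ^ M ∂P₂)
    (p k : ℕ) : ∫ z, u₁ z ^ p * v₁ z ^ k ∂P₁ = ∫ z, u₂ z ^ p * v₂ z ^ k ∂P₂ := by
  have hpoly := Polynomial.funext fun τ => (integral_add_mul_pow_eq_eval h₁ (p + k) τ).symm.trans
    ((h (p + k) τ).trans (integral_add_mul_pow_eq_eval h₂ (p + k) τ))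
  have hcoeff := congrArg (fun Q => Polynomial.coeff Q k) hpoly
  simp only [Polynomial.finsetSum_coeff, Polynomial.coeff_C_mul_X_pow, Finset.sum_ite_eq,
    Finset.mem_range, Nat.add_sub_cancel] at hcoeff
  rw [if_pos (by omega), if_pos (by omega)] at hcoeff
  exact mul_left_cancel₀ (Nat.cast_ne_zero.2 (Nat.choose_pos (Nat.le_add_left k p)).ne') hcoeff

variable {d d' : ℕ} [NeZero d] [NeZero d'] {ν ν' : ℝ}

theorem integral_inner_lift_pow_mul_pow_eq (hν : 0 ≤ ν) (hν' : 0 ≤ ν')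
    (hdim : ν + (d - 1) / 2 = ν' + (d' - 1) / 2)
    {v w : WithLp 2 (EuclideanSpace ℝ (Fin d) × ℝ)}
    {v' w' : WithLp 2 (EuclideanSpace ℝ (Fin d') × ℝ)}
    (hv : ‖v‖ = ‖v'‖) (hw : ‖w‖ = ‖w'‖) (hvw : inner ℝ v w = inner ℝ v' w') (p k : ℕ) :
    ∫ z, inner ℝ v (lift z.1 z.2) ^ p * inner ℝ w (lift z.1 z.2) ^ k ∂(liftLaw d ν) =
      ∫ z, inner ℝ v' (lift z.1 z.2) ^ p * inner ℝ w' (lift z.1 z.2) ^ k ∂(liftLaw d' ν') := by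
  refine integral_pow_mul_pow_eq
    (fun p k => integrable_liftLaw_of_continuous
      (((continuous_inner_lift v).pow p).mul ((continuous_inner_lift w).pow k)))
    (fun p k => integrable_liftLaw_of_continuous
      (((continuous_inner_lift v').pow p).mul ((continuous_inner_lift w').pow k)))
    (fun M τ => ?_) p k
  have hnorm : ‖v + τ • w‖ = ‖v' + τ • w'‖ := by
    rw [← sq_eq_sq₀ (norm_nonneg _) (norm_nonneg _), norm_add_sq_real, norm_add_sq_real, norm_smul,
      norm_smul, inner_smul_right, inner_smul_right, hv, hw, hvw]
  simp only [← real_inner_smul_left, ← inner_add_left]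
  rw [integral_inner_lift_pow hν, integral_inner_lift_pow hν', hnorm, hdim]

end Polarization

section LinearForms

open MvPolynomial

variable {d : ℕ}

/-- The linear form `⟪a, ·⟫` as a polynomial. -/
def linForm (a : EuclideanSpace ℝ (Fin d)) : MvPolynomial (Fin d) ℝ := ∑ i, C (a i) * X i

theorem polyFun_linForm (a y : EuclideanSpace ℝ (Fin d)) :
    polyFun (linForm a) y = inner ℝ a y := by
  simp [polyFun, linForm, PiLp.inner_apply, mul_comm]

theorem polyFun_linForm_pow (a y : EuclideanSpace ℝ (Fin d)) (p : ℕ) :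
    polyFun (linForm a ^ p) y = inner ℝ a y ^ p := by
  rw [← polyFun_linForm, polyFun, map_pow, polyFun]

theorem totalDegree_linForm_le (a : EuclideanSpace ℝ (Fin d)) : (linForm a).totalDegree ≤ 1 :=
  totalDegree_finsetSum_le fun i _ =>
    (totalDegree_mul ..).trans (by rw [totalDegree_C, totalDegree_X])

theorem totalDegree_one_sub_sum_sq_le :
    (1 - ∑ i, X i ^ 2 : MvPolynomial (Fin d) ℝ).totalDegree ≤ 2 := by
  refine (totalDegree_sub ..).trans (max_le (by simp) ?_)
  exact totalDegree_finsetSum_le fun i _ => (totalDegree_X_pow i 2).le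

theorem linForm_pow (a : EuclideanSpace ℝ (Fin d)) (p : ℕ) :
    linForm a ^ p = ∑ k ∈ Finset.piAntidiag Finset.univ p,
      ((Nat.multinomial Finset.univ k : ℝ) * ∏ i, a i ^ k i) • ∏ i, X i ^ k i := by
  rw [linForm, Finset.sum_pow_eq_sum_piAntidiag]
  refine Finset.sum_congr rfl fun k _ => ?_
  simp only [mul_pow, Finset.prod_mul_distrib, smul_eq_C_mul, map_mul, map_natCast, map_prod,
    map_pow, mul_assoc]

/-- The values `φ (linForm a ^ p)` are those at `a` of a polynomial whose coefficients are, up to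
multinomial factors, the values of `φ` at monomials. -/
theorem apply_monomial_eq_zero {p : ℕ} {φ : MvPolynomial (Fin d) ℝ →ₗ[ℝ] ℝ}
    (hφ : ∀ a, φ (linForm a ^ p) = 0) {s : Fin d → ℕ} (hs : ∑ i, s i = p) :
    φ (∏ i, X i ^ s i) = 0 := by
  have hpoly : ∑ k ∈ Finset.piAntidiag Finset.univ p, monomial (Finsupp.equivFunOnFinite.symm k)
      ((Nat.multinomial Finset.univ k : ℝ) * φ (∏ i, X i ^ k i)) = 0 := by
    refine MvPolynomial.funext fun b => ?_
    rw [map_zero, ← hφ (WithLp.toLp 2 b), linForm_pow, map_sum, map_sum]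
    refine Finset.sum_congr rfl fun k _ => ?_
    rw [map_smul, eval_monomial, Finsupp.prod_fintype _ _ (by simp), smul_eq_mul]
    simp only [Finsupp.equivFunOnFinite_symm_apply_apply]
    ring
  have hcoeff := congrArg (coeff (Finsupp.equivFunOnFinite.symm s)) hpoly
  simp only [coeff_sum, coeff_monomial, EmbeddingLike.apply_eq_iff_eq, coeff_zero,
    Finset.sum_ite_eq'] at hcoeff
  rw [if_pos (by simp [hs])] at hcoeff
  exact (mul_eq_zero.1 hcoeff).resolve_left (Nat.cast_ne_zero.2 (Nat.multinomial_pos _ _).ne')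

theorem mem_span_linForm_pow {n : ℕ} {q : MvPolynomial (Fin d) ℝ} (hq : q.totalDegree ≤ n) :
    q ∈ Submodule.span ℝ {P | ∃ a, ∃ p ≤ n, P = linForm a ^ p} := by
  rw [q.as_sum]
  refine Submodule.sum_mem _ fun s hs => ?_
  by_contra hns
  obtain ⟨φ, hφ, hker⟩ := Submodule.exists_le_ker_of_notMem hns
  have hsn : ∑ i, s i ≤ n := by
    rw [← s.sum_fintype (fun _ k => k) fun _ => rfl]
    exact (le_totalDegree hs).trans hq
  refine hφ ?_
  rw [monomial_eq, Finsupp.prod_fintype _ _ (by simp), ← smul_eq_C_mul, map_smul,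
    apply_monomial_eq_zero (fun a => hker (Submodule.subset_span ⟨a, _, hsn, rfl⟩)) rfl, smul_zero]

theorem exists_polyFun_eq_integral_inner_lift_pow {lam : ℝ} (hlam : -(1 / 2) ≤ lam)
    (v : WithLp 2 (EuclideanSpace ℝ (Fin d) × ℝ)) (p : ℕ) :
    ∃ P : MvPolynomial (Fin d) ℝ, P.totalDegree ≤ p ∧ ∀ y, ‖y‖ ≤ 1 →
      polyFun P y = ∫ t, inner ℝ v (lift y t) ^ p ∂(gegenbauerLaw lam) := by
  refine ⟨∑ l ∈ Finset.range (p + 1), C (p.choose l * v.snd ^ (p - l) *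
    gegenbauerMoment lam (p - l)) * (linForm v.fst ^ l * (1 - ∑ i, X i ^ 2) ^ ((p - l) / 2)),
    totalDegree_finsetSum_le fun l hl => ?_, fun y hy => ?_⟩
  · have hl : l < p + 1 := Finset.mem_range.1 hl
    rw [← smul_eq_C_mul]
    calc _ ≤ (linForm v.fst ^ l * (1 - ∑ i, X i ^ 2) ^ ((p - l) / 2)).totalDegree :=
          totalDegree_smul_le ..
      _ ≤ l * 1 + (p - l) / 2 * 2 := (totalDegree_mul ..).trans <| add_le_add
          ((totalDegree_pow ..).trans (Nat.mul_le_mul_left _ (totalDegree_linForm_le _)))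
          ((totalDegree_pow ..).trans (Nat.mul_le_mul_left _ totalDegree_one_sub_sum_sq_le))
      _ ≤ p := by omega
  · simp only [inner_lift]
    rw [integral_add_mul_pow_gegenbauerLaw hlam, height_sq hy, ← polyFun_linForm,
      EuclideanSpace.real_norm_sq_eq]
    simp only [polyFun, map_sum, map_mul, map_pow, map_sub, map_one, eval_C, eval_X]

end LinearForms

section GegenbauerIntegral

open Polynomial

variable {lam : ℝ}

/-- Integration of polynomials against the density proportional to `(1 - t²)^(λ - 1/2)` on
`[-1, 1]`. -/
def gegenbauerIntegral (lam : ℝ) : ℝ[X] →ₗ[ℝ] ℝ where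
  toFun f := ∫ y, f.eval (y 0) ∂(F 1 lam)
  map_add' f g := by
    simp only [eval_add]
    exact integral_add (integrable_of_continuous (by fun_prop))
      (integrable_of_continuous (by fun_prop))
  map_smul' c f := by
    simp only [eval_smul, smul_eq_mul, integral_const_mul, RingHom.id_apply]

theorem gegenbauerIntegral_apply (lam : ℝ) (f : ℝ[X]) :
    gegenbauerIntegral lam f = ∫ y, f.eval (y 0) ∂(F 1 lam) := rfl

theorem gegenbauerIntegral_mul_self_nonneg (lam : ℝ) (f : ℝ[X]) :
    0 ≤ gegenbauerIntegral lam (f * f) := by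
  simp only [gegenbauerIntegral_apply, eval_mul]
  exact integral_nonneg fun y => mul_self_nonneg _

theorem gegenbauerIntegral_X_pow (hlam : -(1 / 2) < lam) (k : ℕ) :
    gegenbauerIntegral lam (X ^ k) = gegenbauerMoment lam k := by
  simp only [gegenbauerIntegral_apply, eval_pow, eval_X, integral_apply_zero_pow_F hlam]

theorem gegenbauerIntegral_one (hlam : -(1 / 2) < lam) : gegenbauerIntegral lam 1 = 1 := by
  have := isProbabilityMeasure_F (d := 1) hlam
  simp [gegenbauerIntegral_apply]

theorem gegenbauerMoment_add_two (hlam : -(1 / 2) < lam) (k : ℕ) :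
    (k + 2 * lam + 2) * gegenbauerMoment lam (k + 2) = (k + 1) * gegenbauerMoment lam k := by
  obtain ⟨i, rfl | rfl⟩ := Nat.even_or_odd' k
  · have hpos : 0 < poch(lam + 1, i) := ascPochhammer_pos _ _ (by linarith)
    have hfac : 0 < lam + 1 + i := by positivity [(by linarith : 0 < lam + 1)]
    rw [gegenbauerMoment, gegenbauerMoment, show 2 * i + 2 = 2 * (i + 1) by ring,
      gaussianMoment_two_mul, gaussianMoment_two_mul, Nat.mul_div_cancel_left _ two_pos,
      Nat.mul_div_cancel_left _ two_pos, ascPochhammer_succ_eval, ascPochhammer_succ_eval]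
    push_cast
    generalize poch(lam + 1, i) = P at hpos ⊢
    field_simp
    ring
  · have hodd := odd_two_mul_add_one i
    rw [gegenbauerMoment_of_odd _ hodd, gegenbauerMoment_of_odd _ (hodd.add_even even_two),
      mul_zero, mul_zero]

theorem isGegenbauer_gegenbauerIntegral (hlam : -(1 / 2) < lam) :
    IsGegenbauer (gegenbauerIntegral lam) lam := by
  suffices h : ∀ k : ℕ, gegenbauerIntegral lam ((1 - X ^ 2) * derivative (X ^ k)) =
      (2 * lam + 1) * gegenbauerIntegral lam (X * X ^ k) by
    intro f
    induction f using Polynomial.induction_on' with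
    | add p q hp hq => rw [derivative_add, mul_add, map_add, hp, hq, mul_add, map_add, mul_add]
    | monomial k c =>
      rw [← C_mul_X_pow_eq_monomial, ← smul_eq_C_mul, derivative_smul, mul_smul_comm, mul_smul_comm,
        map_smul, map_smul, h, smul_eq_mul, smul_eq_mul, mul_left_comm]
  intro k
  rw [← pow_succ', gegenbauerIntegral_X_pow hlam]
  cases k with
  | zero => simp [gegenbauerMoment_of_odd _ odd_one]
  | succ k =>
    rw [derivative_X_pow, Nat.add_sub_cancel,
      show (1 - X ^ 2) * (C ((k + 1 : ℕ) : ℝ) * X ^ k) =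
        C ((k + 1 : ℕ) : ℝ) * (X ^ k - X ^ (k + 2)) by ring,
      map_C_mul, map_sub, gegenbauerIntegral_X_pow hlam, gegenbauerIntegral_X_pow hlam]
    push_cast
    linear_combination -gegenbauerMoment_add_two hlam k

end GegenbauerIntegral

section ConditionalExpectation

open Polynomial

variable {d : ℕ} {ν : ℝ} {w : WithLp 2 (EuclideanSpace ℝ (Fin d) × ℝ)}

@[fun_prop]
theorem continuous_eval_inner_lift (w : WithLp 2 (EuclideanSpace ℝ (Fin d) × ℝ)) (f : ℝ[X]) :
    Continuous fun z : EuclideanSpace ℝ (Fin d) × ℝ => f.eval (inner ℝ w (lift z.1 z.2)) :=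
  f.continuous.comp (continuous_inner_lift w)

@[fun_prop]
theorem continuous_polyFun_fst (q : MvPolynomial (Fin d) ℝ) :
    Continuous fun z : EuclideanSpace ℝ (Fin d) × ℝ => polyFun q z.1 :=
  (continuous_polyFun q).comp continuous_fst

theorem inner_toLp_zero_lift (a y : EuclideanSpace ℝ (Fin d)) (t : ℝ) :
    inner ℝ (WithLp.toLp 2 (a, (0 : ℝ))) (lift y t) = inner ℝ a y := by
  rw [inner_lift]
  simp

/-- The expectation of `q(Y) f(s)`, where `s = ⟪w, Ŷ⟫` for the lift `Ŷ` of `Y`. -/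
def liftPairing (ν : ℝ) (w : WithLp 2 (EuclideanSpace ℝ (Fin d) × ℝ)) :
    MvPolynomial (Fin d) ℝ →ₗ[ℝ] ℝ[X] →ₗ[ℝ] ℝ :=
  LinearMap.mk₂ ℝ
    (fun q f => ∫ z, polyFun q z.1 * f.eval (inner ℝ w (lift z.1 z.2)) ∂(liftLaw d ν))
    (fun q₁ q₂ f => by
      rw [← integral_add (integrable_liftLaw_of_continuous (by fun_prop))
        (integrable_liftLaw_of_continuous (by fun_prop))]
      simp only [polyFun, map_add, add_mul])
    (fun c q f => by
      rw [smul_eq_mul, ← integral_const_mul]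
      simp only [polyFun, MvPolynomial.smul_eval, mul_assoc])
    (fun q f₁ f₂ => by
      rw [← integral_add (integrable_liftLaw_of_continuous (by fun_prop))
        (integrable_liftLaw_of_continuous (by fun_prop))]
      simp only [eval_add, mul_add])
    (fun c q f => by
      rw [smul_eq_mul, ← integral_const_mul]
      simp only [eval_smul, smul_eq_mul, mul_left_comm])

theorem liftPairing_apply (ν : ℝ) (w : WithLp 2 (EuclideanSpace ℝ (Fin d) × ℝ))
    (q : MvPolynomial (Fin d) ℝ) (f : ℝ[X]) :
    liftPairing ν w q f =
      ∫ z, polyFun q z.1 * f.eval (inner ℝ w (lift z.1 z.2)) ∂(liftLaw d ν) := rfl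

/-- For a unit vector `w`, this says that `g(s)` is the conditional expectation of `q(Y)` given
`s = ⟪w, Ŷ⟫`, which follows the Gegenbauer law of index `ν + (d - 1) / 2`. -/
def IsCondExp (ν : ℝ) (w : WithLp 2 (EuclideanSpace ℝ (Fin d) × ℝ))
    (q : MvPolynomial (Fin d) ℝ) (g : ℝ[X]) : Prop :=
  ∀ f, gegenbauerIntegral (ν + (d - 1) / 2) (g * f) = liftPairing ν w q f

theorem isCondExp_of_X_pow {q : MvPolynomial (Fin d) ℝ} {g : ℝ[X]}
    (h : ∀ k : ℕ, gegenbauerIntegral (ν + (d - 1) / 2) (g * X ^ k) = liftPairing ν w q (X ^ k)) :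
    IsCondExp ν w q g := by
  intro f
  induction f using Polynomial.induction_on' with
  | add p q hp hq => rw [mul_add, map_add, map_add, hp, hq]
  | monomial k c =>
    rw [← C_mul_X_pow_eq_monomial, ← smul_eq_C_mul, mul_smul_comm, map_smul, map_smul, h]

theorem isCondExp_one [NeZero d] (hν : 0 ≤ ν) (hw : ‖w‖ = 1) : IsCondExp ν w 1 1 := by
  have hd : (1 : ℝ) ≤ d := Nat.one_le_cast.2 NeZero.one_le
  refine isCondExp_of_X_pow fun k => ?_
  simp only [liftPairing_apply, polyFun, map_one, one_mul, eval_pow, eval_X,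
    integral_inner_lift_pow hν, hw, one_pow]
  exact gegenbauerIntegral_X_pow (by linarith) k

theorem exists_norm_eq_apply_fst_eq_inner {V : Type*} [NormedAddCommGroup V]
    [InnerProductSpace ℝ V] {w : V} (hw : ‖w‖ = 1) (v : V) :
    ∃ u : WithLp 2 (EuclideanSpace ℝ (Fin 1) × ℝ), ‖u‖ = ‖v‖ ∧ u.fst 0 = inner ℝ v w := by
  have hle : inner ℝ v w ^ 2 ≤ ‖v‖ ^ 2 := by
    rw [← sq_abs]
    gcongr
    simpa [hw] using abs_real_inner_le_norm v w
  refine ⟨WithLp.toLp 2 (EuclideanSpace.single 0 (inner ℝ v w), √(‖v‖ ^ 2 - inner ℝ v w ^ 2)), ?_,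
    by simp⟩
  rw [WithLp.prod_norm_eq_of_L2, Real.sqrt_eq_iff_eq_sq (by positivity) (norm_nonneg v)]
  simp [Real.sq_sqrt (sub_nonneg.2 hle)]

theorem exists_eval_eq_integral_inner_lift_pow {lam : ℝ} (hlam : -(1 / 2) ≤ lam)
    (v : WithLp 2 (EuclideanSpace ℝ (Fin 1) × ℝ)) (p : ℕ) :
    ∃ g ∈ degreeLT ℝ (p + 1), ∀ y : EuclideanSpace ℝ (Fin 1), ‖y‖ ≤ 1 →
      g.eval (y 0) = ∫ t, inner ℝ v (lift y t) ^ p ∂(gegenbauerLaw lam) := by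
  obtain ⟨P, hdeg, hP⟩ := exists_polyFun_eq_integral_inner_lift_pow hlam v p
  refine ⟨MvPolynomial.aeval (fun _ => X) P, ?_, fun y hy => ?_⟩
  · rw [mem_degreeLT]
    refine degree_le_natDegree.trans_lt (Nat.cast_lt.2 (Nat.lt_succ_of_le ?_))
    simpa using (MvPolynomial.aeval_natDegree_le P hdeg (fun _ => X) (n := 1)
      (fun _ => natDegree_X_le))
  · rw [← hP y hy, ← coe_evalRingHom, MvPolynomial.aeval_def, MvPolynomial.hom_eval₂, polyFun,
      MvPolynomial.eval, MvPolynomial.coe_eval₂Hom]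
    congr 1
    · ext
      simp
    · ext i
      simp [Subsingleton.elim i 0]

theorem exists_isCondExp_linForm_pow [NeZero d] (hν : 0 ≤ ν) (hw : ‖w‖ = 1)
    (a : EuclideanSpace ℝ (Fin d)) (p : ℕ) :
    ∃ g ∈ degreeLT ℝ (p + 1), g.eval 1 = inner ℝ a w.fst ^ p ∧
      IsCondExp ν w (linForm a ^ p) g := by
  have hd : (1 : ℝ) ≤ d := Nat.one_le_cast.2 NeZero.one_le
  set lam := ν + ((d : ℝ) - 1) / 2 with hlam
  have hlam0 : 0 ≤ lam := by linarith
  obtain ⟨u, hu, hu0⟩ := exists_norm_eq_apply_fst_eq_inner hw (WithLp.toLp 2 (a, 0))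
  have huw : u.fst 0 = inner ℝ a w.fst := by simpa [WithLp.prod_inner_apply] using hu0
  obtain ⟨g, hdeg, hg⟩ :=
    exists_eval_eq_integral_inner_lift_pow (show -(1 / 2) ≤ lam - 1 / 2 by linarith) u p
  refine ⟨g, hdeg, ?_, isCondExp_of_X_pow fun k => ?_⟩
  · have := isProbabilityMeasure_gegenbauerLaw (show -(1 / 2) ≤ lam - 1 / 2 by linarith)
    have hpole : ∀ t, inner ℝ u (lift (EuclideanSpace.single 0 1) t) = inner ℝ a w.fst := by
      intro t
      rw [inner_lift, EuclideanSpace.inner_single_right, huw]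
      simp [height]
    have heval := hg (EuclideanSpace.single 0 1) (by simp)
    simp only [hpole, integral_const, probReal_univ, one_smul] at heval
    simpa using heval
  · have hinner := integral_inner_lift_pow_mul_pow_eq hν hlam0 (by simp [hlam]) hu.symm
      (w := w) (w' := WithLp.toLp 2 (EuclideanSpace.single 0 1, 0))
      (by simp [hw])
      (by rw [← hu0, real_inner_comm, WithLp.prod_inner_apply]
          simp [EuclideanSpace.inner_single_left]) p k
    simp only [inner_toLp_zero_lift, EuclideanSpace.inner_single_left, map_one, one_mul] at hinner
    simp only [liftPairing_apply, polyFun_linForm_pow, eval_pow, eval_X, gegenbauerIntegral_apply,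
      eval_mul, ← hlam]
    rw [hinner, liftLaw, integral_prod _ (integrable_liftLaw_of_continuous (by fun_prop))]
    refine integral_congr_ae ?_
    filter_upwards [ae_mem_unitBall 1 lam] with y hy
    rw [integral_mul_const, hg y (mem_closedBall_zero_iff.1 hy)]

theorem exists_isCondExp [NeZero d] (hν : 0 ≤ ν) (hw : ‖w‖ = 1) {n : ℕ}
    {q : MvPolynomial (Fin d) ℝ} (hq : q.totalDegree ≤ n) :
    ∃ g ∈ degreeLT ℝ (n + 1), g.eval 1 = polyFun q w.fst ∧ IsCondExp ν w q g := by
  have hspan := mem_span_linForm_pow hq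
  clear hq
  induction hspan using Submodule.span_induction with
  | mem _ h =>
    obtain ⟨a, p, hp, rfl⟩ := h
    obtain ⟨g, hdeg, hg1, hg⟩ := exists_isCondExp_linForm_pow hν hw a p
    exact ⟨g, degreeLT_mono (by omega) hdeg, by rw [hg1, polyFun_linForm_pow], hg⟩
  | zero => exact ⟨0, zero_mem _, by simp [polyFun], fun f => by simp⟩
  | add q₁ q₂ _ _ h₁ h₂ =>
    obtain ⟨g₁, hdeg₁, hone₁, hg₁⟩ := h₁
    obtain ⟨g₂, hdeg₂, hone₂, hg₂⟩ := h₂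
    refine ⟨g₁ + g₂, add_mem hdeg₁ hdeg₂, by simp [polyFun, hone₁, hone₂], fun f => ?_⟩
    rw [add_mul, map_add, hg₁, hg₂, map_add, LinearMap.add_apply]
  | smul c q _ h =>
    obtain ⟨g, hdeg, hone, hg⟩ := h
    refine ⟨c • g, Submodule.smul_mem _ _ hdeg, by simp [polyFun, hone], fun f => ?_⟩
    rw [smul_mul_assoc, map_smul, hg, map_smul, LinearMap.smul_apply]

theorem liftPairing_X_pow_eq_zero (hν : 0 ≤ ν) (w : WithLp 2 (EuclideanSpace ℝ (Fin d) × ℝ))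
    {n : ℕ} {q : MvPolynomial (Fin d) ℝ} (hq : q ∈ Y d ν n) {k : ℕ} (hk : k < n) :
    liftPairing ν w q (X ^ k) = 0 := by
  obtain ⟨P, hdeg, hP⟩ := exists_polyFun_eq_integral_inner_lift_pow
    (show -(1 / 2) ≤ ν - 1 / 2 by linarith) w k
  rw [← hq.2 P (hdeg.trans_lt hk), polyInner, liftPairing_apply, liftLaw,
    integral_prod _ (integrable_liftLaw_of_continuous (by fun_prop))]
  refine integral_congr_ae ?_
  filter_upwards [ae_mem_unitBall d ν] with y hy
  simp only [eval_pow, eval_X]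
  rw [integral_const_mul, hP y (mem_closedBall_zero_iff.1 hy)]

namespace IsCondExp

theorem isOrthogonalPoly {q : MvPolynomial (Fin d) ℝ} {g : ℝ[X]} (hg : IsCondExp ν w q g)
    (hν : 0 ≤ ν) {n : ℕ} (hq : q ∈ Y d ν n) (hdeg : g ∈ degreeLT ℝ (n + 1)) :
    IsOrthogonalPoly (gegenbauerIntegral (ν + (d - 1) / 2)) n g := by
  refine ⟨hdeg, fun f hf => ?_⟩
  suffices h : degreeLT ℝ n ≤ LinearMap.ker (liftPairing ν w q) from (hg f).trans (h hf)
  rw [degreeLT_eq_span_X_pow, Submodule.span_le]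
  simp only [Finset.coe_image, Finset.coe_range, Set.image_subset_iff]
  exact fun k hk => liftPairing_X_pow_eq_zero hν w hq hk

theorem gegenbauerIntegral_mul_self_le [NeZero d] {q : MvPolynomial (Fin d) ℝ} {g : ℝ[X]}
    (hg : IsCondExp ν w q g) (hν : 0 ≤ ν) (hw : ‖w‖ = 1) :
    gegenbauerIntegral (ν + (d - 1) / 2) (g * g) ≤ polyInner d ν q q := by
  have := isProbabilityMeasure_gegenbauerLaw (show -(1 / 2) ≤ ν - 1 / 2 by linarith)
  have hnorm : liftPairing ν w 1 (g * g) = gegenbauerIntegral (ν + (d - 1) / 2) (g * g) := by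
    rw [← isCondExp_one hν hw, one_mul]
  have hsq : ∫ z, polyFun q z.1 * polyFun q z.1 ∂(liftLaw d ν) = polyInner d ν q q := by
    rw [liftLaw, integral_fun_fst fun y => polyFun q y * polyFun q y, probReal_univ, one_smul,
      polyInner]
  have hexp : ∫ z, (polyFun q z.1 - g.eval (inner ℝ w (lift z.1 z.2))) ^ 2 ∂(liftLaw d ν) =
      polyInner d ν q q - 2 * liftPairing ν w q g + liftPairing ν w 1 (g * g) := by
    rw [← hsq, liftPairing_apply, liftPairing_apply, ← integral_const_mul, ← integral_sub,
      ← integral_add]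
    · simp only [polyFun, map_one, eval_mul]
      exact integral_congr_ae (.of_forall fun z => by ring)
    all_goals exact integrable_liftLaw_of_continuous (by fun_prop)
  have hpos : 0 ≤ ∫ z, (polyFun q z.1 - g.eval (inner ℝ w (lift z.1 z.2))) ^ 2 ∂(liftLaw d ν) :=
    integral_nonneg fun z => sq_nonneg _
  rw [hexp, hnorm, ← hg] at hpos
  linarith

end IsCondExp

end ConditionalExpectation

section PointEvaluation

open Polynomial

variable {d : ℕ} [NeZero d] {ν : ℝ} {n : ℕ} {x : EuclideanSpace ℝ (Fin d)}

theorem polyFun_sq_le (hν : 0 ≤ ν) (hn : 1 ≤ n) (hx : ‖x‖ ≤ 1) {lam : ℝ}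
    (hlam : lam = ν + (d - 1) / 2) {q : MvPolynomial (Fin d) ℝ} (hq : q ∈ Y d ν n) :
    polyFun q x ^ 2 ≤
      (2 * lam + 2) * Real.exp (2 * lam) * (n : ℝ) ^ (2 * lam) * polyInner d ν q q := by
  have hd : (1 : ℝ) ≤ d := Nat.one_le_cast.2 NeZero.one_le
  have hlam0 : 0 ≤ lam := by linarith
  have hunit := norm_lift_one hx
  obtain ⟨g, hdeg, hone, hg⟩ := exists_isCondExp hν hunit hq.1
  have hsq : 0 ≤ gegenbauerIntegral lam (g * g) :=
    gegenbauerIntegral_mul_self_nonneg lam g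
  have hbound := (isGegenbauer_gegenbauerIntegral (by linarith)).eval_one_sq_mul_map_one_le hlam0
    (by rw [gegenbauerIntegral_one (by linarith)]; exact one_ne_zero) hn
    (hlam ▸ hg.isOrthogonalPoly hν hq hdeg) hsq
  rw [gegenbauerIntegral_one (by linarith), mul_one, hone] at hbound
  refine hbound.trans ?_
  gcongr
  exact hlam ▸ hg.gegenbauerIntegral_mul_self_le hν hunit

theorem polyInner_sum_smul {d : ℕ} {ν : ℝ} {ι : Type*} [Fintype ι] [DecidableEq ι]
    {p : ι → MvPolynomial (Fin d) ℝ}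
    (hp : ∀ j k, polyInner d ν (p j) (p k) = if j = k then 1 else 0) (r : ι → ℝ) :
    polyInner d ν (∑ k, r k • p k) (∑ k, r k • p k) = ∑ k, r k ^ 2 := by
  calc polyInner d ν (∑ k, r k • p k) (∑ k, r k • p k)
      = ∫ y, ∑ j, ∑ k, r j * r k * (polyFun (p j) y * polyFun (p k) y) ∂(F d ν) := by
        refine integral_congr_ae (.of_forall fun y => ?_)
        simp only [polyFun, map_sum, MvPolynomial.smul_eval, Finset.sum_mul_sum, mul_mul_mul_comm]
    _ = ∑ j, ∑ k, r j * r k * polyInner d ν (p j) (p k) := by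
        rw [integral_finsetSum _ fun j _ => integrable_finsetSum _ fun k _ =>
          (integrable_mul d ν _ _).const_mul _]
        refine Finset.sum_congr rfl fun j _ => ?_
        rw [integral_finsetSum _ fun k _ => (integrable_mul d ν _ _).const_mul _]
        simp only [integral_const_mul, polyInner]
    _ = ∑ k, r k ^ 2 := by simp [hp, sq]

theorem sum_polyFun_sq_le (hν : 0 ≤ ν) (hn : 1 ≤ n) (hx : ‖x‖ ≤ 1) {lam : ℝ}
    (hlam : lam = ν + (d - 1) / 2) {ι : Type*} [Fintype ι] [DecidableEq ι]
    {p : ι → MvPolynomial (Fin d) ℝ} (hpY : ∀ k, p k ∈ Y d ν n)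
    (hp : ∀ j k, polyInner d ν (p j) (p k) = if j = k then 1 else 0) :
    ∑ k, polyFun (p k) x ^ 2 ≤ (2 * lam + 2) * Real.exp (2 * lam) * (n : ℝ) ^ (2 * lam) := by
  have hd : (1 : ℝ) ≤ d := Nat.one_le_cast.2 NeZero.one_le
  have hlam0 : 0 ≤ lam := by linarith
  have hkernel : polyFun (∑ k, polyFun (p k) x • p k) x = ∑ k, polyFun (p k) x ^ 2 := by
    simp only [polyFun, map_sum, MvPolynomial.smul_eval, sq]
  have hle := polyFun_sq_le hν hn hx hlam
    (Submodule.sum_mem (t := Finset.univ) _ fun k _ =>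
      Submodule.smul_mem _ (polyFun (p k) x) (hpY k))
  rw [polyInner_sum_smul hp, hkernel, sq] at hle
  rcases (Finset.sum_nonneg fun k _ => sq_nonneg (polyFun (p k) x)).eq_or_lt with h0 | hpos
  · rw [← h0]
    positivity
  · exact le_of_mul_le_mul_right hle hpos

end PointEvaluation

theorem norm_sq_le_norm_sum_sq {T ι : Type*} [TopologicalSpace T] [CompactSpace T] [Fintype ι]
    (f : ι → C(T, ℝ)) (k : ι) : ‖f k‖ ^ 2 ≤ ‖∑ j, f j ^ 2‖ := by
  refine (Real.le_sqrt (norm_nonneg _) (norm_nonneg _)).1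
    ((ContinuousMap.norm_le _ (Real.sqrt_nonneg _)).2 fun x => Real.le_sqrt_of_sq_le ?_)
  calc ‖f k x‖ ^ 2 = f k x ^ 2 := by rw [Real.norm_eq_abs, sq_abs]
    _ ≤ ∑ j, f j x ^ 2 :=
      Finset.single_le_sum (f := fun j => f j x ^ 2) (fun j _ => sq_nonneg _) (Finset.mem_univ k)
    _ = (∑ j, f j ^ 2) x := by simp
    _ ≤ ‖∑ j, f j ^ 2‖ := (∑ j, f j ^ 2).apply_le_norm x

theorem norm_sum_onBall_sq_le {d n : ℕ} [NeZero d] {ν : ℝ} (hν : 0 ≤ ν) (hn : 1 ≤ n) {lam : ℝ}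
    (hlam : lam = ν + (d - 1) / 2) {ι : Type*} [Fintype ι] [DecidableEq ι]
    {p : ι → MvPolynomial (Fin d) ℝ} (hpY : ∀ k, p k ∈ Y d ν n)
    (hp : ∀ j k, polyInner d ν (p j) (p k) = if j = k then 1 else 0) :
    ‖∑ k, onBall (p k) ^ 2‖ ≤ (2 * lam + 2) * Real.exp (2 * lam) * (n : ℝ) ^ (2 * lam) := by
  have hd : (1 : ℝ) ≤ d := Nat.one_le_cast.2 NeZero.one_le
  have hlam0 : 0 ≤ lam := by linarith
  refine (ContinuousMap.norm_le _ (by positivity)).2 fun x => ?_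
  have hnonneg : 0 ≤ ∑ k, polyFun (p k) x ^ 2 := Finset.sum_nonneg fun k _ => sq_nonneg _
  rw [ContinuousMap.sum_apply]
  exact (Real.norm_of_nonneg hnonneg).trans_le
    (sum_polyFun_sq_le hν hn (mem_closedBall_zero_iff.1 x.2) hlam hpY hp)

end

end BallPoly

theorem lemma4p1 (d : ℕ) (hd : 1 ≤ d) (ν : ℝ) (hν : 0 ≤ ν) :
    ∃ C : ℝ, 0 < C ∧ ∀ n : ℕ, 1 ≤ n →
      ∀ p : Module.Basis (Fin (Module.finrank ℝ (BallPoly.Y d ν n))) ℝ (BallPoly.Y d ν n),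
        BallPoly.IsOrthonormalBasis p →
        (∀ k, ‖BallPoly.onBall (p k : MvPolynomial (Fin d) ℝ)‖ ≤
          C * (n : ℝ) ^ (ν + ((d : ℝ) - 1) / 2)) ∧
        ‖∑ k, BallPoly.onBall (p k : MvPolynomial (Fin d) ℝ) ^ 2‖ ≤
          C * (n : ℝ) ^ (2 * ν + (d : ℝ) - 1) := by
  have : NeZero d := ⟨by omega⟩
  have hd' : (1 : ℝ) ≤ d := Nat.one_le_cast.2 hd
  generalize hlam : ν + ((d : ℝ) - 1) / 2 = lam
  obtain ⟨K, hK⟩ : ∃ K, K = (2 * lam + 2) * Real.exp (2 * lam) := ⟨_, rfl⟩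
  have hK1 : 1 ≤ K :=
    hK ▸ one_le_mul_of_one_le_of_one_le (by linarith) (Real.one_le_exp (by linarith))
  refine ⟨K, by linarith, fun n hn p hp => ?_⟩
  have hsum := BallPoly.norm_sum_onBall_sq_le hν hn hlam.symm (fun k => (p k).2) hp
  rw [← hK] at hsum
  refine ⟨fun k => le_of_sq_le_sq ?_ (by positivity), ?_⟩
  · calc ‖BallPoly.onBall (p k : MvPolynomial (Fin d) ℝ)‖ ^ 2
        ≤ K * (n : ℝ) ^ (2 * lam) := (BallPoly.norm_sq_le_norm_sum_sq
          (fun j => BallPoly.onBall (p j : MvPolynomial (Fin d) ℝ)) k).trans hsum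
      _ ≤ K ^ 2 * (n : ℝ) ^ (2 * lam) := by
        gcongr
        exact le_self_pow₀ hK1 two_ne_zero
      _ = (K * (n : ℝ) ^ lam) ^ 2 := by
        rw [mul_pow, ← Real.rpow_mul_natCast (Nat.cast_nonneg n), Nat.cast_two, mul_comm lam 2]
  · rwa [show 2 * ν + (d : ℝ) - 1 = 2 * lam by rw [← hlam]; ring]
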